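/- Conventions. Let $P\subset\mathbb R^d$ be a convex polytope. For $c\in\mathbb R^d$ let $P^c=\{x\in P:\langle c,x\rangle\ge\langle c,y\rangle\text{ for all }y\in P\}$; the (non-empty) faces of $P$ are the sets $P^c$. The normal cone of $P$ at a face $F$ is $N_FP=\{c: F\subseteq P^c\}$, and the normal fan $\mathcal N(P)$ is the collection of all these cones. Two polytopes $P,Q$ are normally equivalent if for every $c\in\mathbb R^d$ the affine hulls of $P^c$ and $Q^c$ differ by a translation. A polytope is inscribed if its vertices lie on a common sphere. The inscribed cone $\mathrm{InCone}(P)$ is the set of inscribed polytopes normally equivalent to $P$, modulo translations; by passing to support functions $h_Q(c)=\max_{x\in Q}\langle c,x\rangle$ it is regarded as a subset of the vector space of functions $\mathbb R^d\to\mathbb R$ modulo linear functions, and $\dim\mathrm{InCone}(P)$ is the dimension of its affine hull there. $P$ is normally inscribable if $\mathrm{InCone}(P)\ne\emptyset$. $P$ is even if every $2$-dimensional face of $P$ has an even number of vertices. The regions of $\mathcal N(P)$ are its inclusion-maximal cones, and two distinct regions $R,R'$ are adjacent if $R\cap R'$ is a cone of the fan of dimension $d-1$; in that case $s_{RR'}$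 denotes the orthogonal reflection in the linear hyperplane spanned by $R\cap R'$. A walk $\mathcal W=R_0R_1\dots R_k$ of successively adjacent regions yields $t_{\mathcal W}=s_{R_kR_{k-1}}\cdots s_{R_2R_1}s_{R_1R_0}$. The inscribed space $\mathrm{InSpc}(P,R_0)$ based at a region $R_0$ is the linear subspace of all $v\in\mathbb R^d$ that are orthogonal to the lineality space of $\mathcal N(P)$ and satisfy $t_{\mathcal W}(v)=v$ for all closed walks $\mathcal W$ starting in $R_0$. Theorem. Let $P\subset\mathbb R^d$ be a normally inscribable, full-dimensional polytope. Then the following are equivalent: (i) $P$ is even; (ii) $\dim\mathrm{InCone}(P)=d$; (iii) $\mathrm{InSpc}(P,R_0)=\mathbb R^d$ for every region $R_0$ of $\mathcal N(P)$; (iii') $\mathrm{InSpc}(P,R_0)=\mathbb R^d$ for some region $R_0$ of $\mathcal N(P)$. -/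

import Mathlib

noncomputable section

namespace InscribedFan

/-- Euclidean space `ℝ^d`. -/
abbrev Space (d : ℕ) : Type := EuclideanSpace ℝ (Fin d)

/-! ### Polytopes, faces, normal fans -/

/-- A (non-empty) convex polytope: the convex hull of a non-empty finite set of points. -/
def IsPolytope {d : ℕ} (P : Set (Space d)) : Prop :=
  ∃ S : Finset (Space d), S.Nonempty ∧ P = convexHull ℝ (S : Set (Space d))

/-- `P` is full-dimensional: its affine hull is the whole space. -/
def IsFullDimensional {d : ℕ} (P : Set (Space d)) : Prop :=
  affineSpan ℝ P = ⊤

/-- The vertices of `P`. -/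
abbrev vertices {d : ℕ} (P : Set (Space d)) : Set (Space d) :=
  P.extremePoints ℝ

/-- The face `P^c` of `P` on which the linear function `x ↦ ⟨c, x⟩` is maximal over `P`. -/
def maxFace {d : ℕ} (P : Set (Space d)) (c : Space d) : Set (Space d) :=
  {x | x ∈ P ∧ ∀ y ∈ P, inner ℝ c y ≤ inner ℝ c x}

/-- The (non-empty) faces of a polytope `P` are the sets `P^c`; in particular `P = P^0`. -/
def IsFace {d : ℕ} (P F : Set (Space d)) : Prop :=
  ∃ c : Space d, F = maxFace P c

/-- The normal cone `N_F P = {c | F ⊆ P^c}`. -/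
def normalCone {d : ℕ} (P F : Set (Space d)) : Set (Space d) :=
  {c | F ⊆ maxFace P c}

/-- The normal fan of `P`, as a collection of cones: all normal cones at faces of `P`. -/
def normalFan {d : ℕ} (P : Set (Space d)) : Set (Set (Space d)) :=
  {N | ∃ F, IsFace P F ∧ N = normalCone P F}

/-- `P` is even: every 2-dimensional face has an even number of vertices. -/
def IsEven {d : ℕ} (P : Set (Space d)) : Prop :=
  ∀ F, IsFace P F → Module.finrank ℝ (vectorSpan ℝ F) = 2 → Even (vertices F).ncard

/-! ### Inscribed polytopes and the inscribed cone -/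

/-- `P` is inscribed: its vertices lie on a common sphere. -/
def IsInscribed {d : ℕ} (P : Set (Space d)) : Prop :=
  EuclideanGeometry.Cospherical (vertices P)

/-- `P` and `Q` are normally equivalent: for every `c`, the affine hulls of `P^c` and `Q^c`
differ by a translation. -/
def NormallyEquivalent {d : ℕ} (P Q : Set (Space d)) : Prop :=
  ∀ c : Space d, (affineSpan ℝ (maxFace P c)).Parallel (affineSpan ℝ (maxFace Q c))

/-- The support function `h_P(c) = max {⟨c, x⟩ | x ∈ P}`. -/
def supportFunction {d : ℕ} (P : Set (Space d)) (c : Space d) : ℝ :=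
  sSup ((fun x => inner ℝ c x) '' P)

/-- The linear functions, as a subspace of all functions `ℝ^d → ℝ`. -/
def linearFunctions (d : ℕ) : Submodule ℝ (Space d → ℝ) :=
  LinearMap.range (LinearMap.ltoFun ℝ (Space d) ℝ ℝ)

/-- The real vector space of functions `ℝ^d → ℝ` modulo linear functions. -/
abbrev FunctionsModLinear (d : ℕ) : Type := (Space d → ℝ) ⧸ linearFunctions d

/-- The class of the support function of `P` modulo linear functions. For polytopes it represents
precisely the translation class of `P` (see `supportClass_eq_iff`), and it turns Minkowski sums and
positive dilations into sums and positive multiples. -/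
def supportClass {d : ℕ} (P : Set (Space d)) : FunctionsModLinear d :=
  (linearFunctions d).mkQ (supportFunction P)

/-- The inscribed cone of `P`: all inscribed polytopes normally equivalent to `P`, modulo
translations (a translation class being represented by its class of support functions). -/
def inscribedCone {d : ℕ} (P : Set (Space d)) : Set (FunctionsModLinear d) :=
  {q | ∃ Q, IsPolytope Q ∧ NormallyEquivalent P Q ∧ IsInscribed Q ∧ q = supportClass Q}

/-- `P` is normally inscribable: its inscribed cone is non-empty. -/
def IsNormallyInscribable {d : ℕ} (P : Set (Space d)) : Prop :=
  (inscribedCone P).Nonempty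

/-- The dimension of a subset of a real vector space (used for convex cones): the dimension of its
affine hull. -/
def setDim {V : Type*} [AddCommGroup V] [Module ℝ V] (K : Set V) : Cardinal :=
  Module.rank ℝ (vectorSpan ℝ K)

/-! ### The reflection game on a fan -/

/-- The regions of a fan: its inclusion-maximal cones. -/
abbrev Region {d : ℕ} (𝓕 : Set (Set (Space d))) : Type :=
  {R : Set (Space d) // Maximal (· ∈ 𝓕) R}

/-- A wall of a full-dimensional fan in `ℝ^d`: a cone of dimension `d - 1` in the fan. -/
def IsWall {d : ℕ} (𝓕 : Set (Set (Space d))) (W : Set (Space d)) : Prop :=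
  W ∈ 𝓕 ∧ Module.finrank ℝ (Submodule.span ℝ W) + 1 = d

/-- The dual graph of a fan: distinct regions are adjacent if they meet in a wall. -/
def dualGraph {d : ℕ} (𝓕 : Set (Set (Space d))) : SimpleGraph (Region 𝓕) where
  Adj R R' := R ≠ R' ∧ IsWall 𝓕 (R.1 ∩ R'.1)
  symm := ⟨fun R R' h => ⟨h.1.symm, by rw [Set.inter_comm]; exact h.2⟩⟩
  loopless := ⟨fun _ h => h.1 rfl⟩

/-- The orthogonal reflection `s_{RR'}` in the linear hull of `R ∩ R'`. -/
def wallReflection {d : ℕ} (R R' : Set (Space d)) : Space d ≃ₗᵢ[ℝ] Space d :=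
  (Submodule.span ℝ (R ∩ R')).reflection

/-- The orthogonal transformation `t_W = s_{R_k R_{k-1}} ⋯ s_{R_2 R_1} s_{R_1 R_0}` of a walk
`W = R_0 R_1 … R_k` in the dual graph. -/
def walkTransform {d : ℕ} {𝓕 : Set (Set (Space d))} {R S : Region 𝓕} :
    (dualGraph 𝓕).Walk R S → (Space d ≃ₗᵢ[ℝ] Space d)
  | .nil => LinearIsometryEquiv.refl ℝ (Space d)
  | .cons (v := R') _ w => (wallReflection R.1 R'.1).trans (walkTransform w)

/-- The lineality space of a fan: the points `x` such that `x` and `-x` lie in all cones. -/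
def lineality {d : ℕ} (𝓕 : Set (Set (Space d))) : Set (Space d) :=
  {x | ∀ C ∈ 𝓕, x ∈ C ∧ -x ∈ C}

/-- The inscribed space of a fan based at `R₀`: all vectors orthogonal to the lineality space that
are fixed by `t_W` for all closed walks `W` in the dual graph starting in `R₀`. -/
def basedInscribedSpace {d : ℕ} (𝓕 : Set (Set (Space d))) (R₀ : Region 𝓕) :
    Submodule ℝ (Space d) where
  carrier := {v | (∀ x ∈ lineality 𝓕, inner ℝ x v = 0) ∧
    ∀ w : (dualGraph 𝓕).Walk R₀ R₀, walkTransform w v = v}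
  zero_mem' := ⟨fun x _ => inner_zero_right x, fun w => map_zero (walkTransform w)⟩
  add_mem' {u v} hu hv :=
    ⟨fun x hx => by rw [inner_add_right, hu.1 x hx, hv.1 x hx, add_zero],
      fun w => by rw [map_add, hu.2 w, hv.2 w]⟩
  smul_mem' a v hv :=
    ⟨fun x hx => by rw [inner_smul_right, hv.1 x hx, mul_zero],
      fun w => by rw [map_smul, hv.2 w]⟩

/-! ### Support classes of polytopes are translation classes -/

theorem IsPolytope.isCompact {d : ℕ} {P : Set (Space d)} (hP : IsPolytope P) : IsCompact P := by
  obtain ⟨S, -, rfl⟩ := hP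
  exact S.finite_toSet.isCompact_convexHull (𝕜 := ℝ)

theorem IsPolytope.convex {d : ℕ} {P : Set (Space d)} (hP : IsPolytope P) : Convex ℝ P := by
  obtain ⟨S, -, rfl⟩ := hP
  exact convex_convexHull ℝ _

theorem IsPolytope.nonempty {d : ℕ} {P : Set (Space d)} (hP : IsPolytope P) : P.Nonempty := by
  obtain ⟨S, hS, rfl⟩ := hP
  exact (Finset.coe_nonempty.2 hS).convexHull

theorem IsPolytope.inner_le {d : ℕ} {P : Set (Space d)} (hP : IsPolytope P) {x : Space d}
    (hx : x ∈ P) (c : Space d) : inner ℝ c x ≤ supportFunction P c := by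
  refine le_csSup ?_ ⟨x, hx, rfl⟩
  exact (hP.isCompact.image (by fun_prop)).bddAbove

theorem supportFunction_translate {d : ℕ} {P Q : Set (Space d)} (hP : IsPolytope P)
    (hQ : IsPolytope Q) {t : Space d} (h : ∀ x, x ∈ Q ↔ x - t ∈ P) (c : Space d) :
    supportFunction Q c = supportFunction P c + inner ℝ c t := by
  apply le_antisymm
  · refine csSup_le (hQ.nonempty.image _) ?_
    rintro _ ⟨x, hx, rfl⟩
    have := hP.inner_le ((h x).1 hx) c
    rw [inner_sub_right] at this
    dsimp only
    linarith
  · rw [← le_sub_iff_add_le]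
    refine csSup_le (hP.nonempty.image _) ?_
    rintro _ ⟨x, hx, rfl⟩
    have := hQ.inner_le ((h (x + t)).2 (by simpa using hx)) c
    rw [inner_add_right] at this
    dsimp only
    linarith

theorem mem_iff_le_supportFunction {d : ℕ} {P : Set (Space d)} (hP : IsPolytope P) (x : Space d) :
    x ∈ P ↔ ∀ c, inner ℝ c x ≤ supportFunction P c := by
  refine ⟨fun hx c => hP.inner_le hx c, fun h => ?_⟩
  by_contra hx
  obtain ⟨f, u, hu, hux⟩ :=
    geometric_hahn_banach_closed_point hP.convex hP.isCompact.isClosed hx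
  have key : ∀ y, inner ℝ ((InnerProductSpace.toDual ℝ (Space d)).symm f) y = f y := fun y =>
    InnerProductSpace.toDual_symm_apply
  have h1 := h ((InnerProductSpace.toDual ℝ (Space d)).symm f)
  have h2 : supportFunction P ((InnerProductSpace.toDual ℝ (Space d)).symm f) ≤ u := by
    refine csSup_le (hP.nonempty.image _) ?_
    rintro _ ⟨y, hy, rfl⟩
    dsimp only
    rw [key]
    exact (hu y hy).le
  rw [key] at h1
  linarith

/-- Two polytopes have the same support class if and only if they are translates of each other. -/
theorem supportClass_eq_iff {d : ℕ} {P Q : Set (Space d)} (hP : IsPolytope P)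
    (hQ : IsPolytope Q) :
    supportClass Q = supportClass P ↔ ∃ t : Space d, ∀ x, x ∈ Q ↔ x - t ∈ P := by
  unfold supportClass
  rw [Submodule.mkQ_apply, Submodule.mkQ_apply, Submodule.Quotient.eq]
  constructor
  · rintro ⟨f, hf⟩
    have key : ∀ c, inner ℝ ((InnerProductSpace.toDual ℝ (Space d)).symm
        (LinearMap.toContinuousLinearMap f)) c = f c := fun c =>
      InnerProductSpace.toDual_symm_apply
    refine ⟨(InnerProductSpace.toDual ℝ (Space d)).symm (LinearMap.toContinuousLinearMap f),
      fun x => ?_⟩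
    rw [mem_iff_le_supportFunction hP, mem_iff_le_supportFunction hQ]
    refine forall_congr' fun c => ?_
    have h1 : f c = supportFunction Q c - supportFunction P c := congrFun hf c
    rw [inner_sub_right, ← real_inner_comm c (LinearIsometryEquiv.symm _ _), key, h1]
    constructor <;> intro h <;> linarith
  · rintro ⟨t, ht⟩
    refine ⟨(innerSL ℝ t).toLinearMap, ?_⟩
    funext c
    have h := supportFunction_translate hP hQ ht c
    have h2 : inner ℝ t c = supportFunction Q c - supportFunction P c := by
      rw [h, real_inner_comm]; ring
    exact h2

end InscribedFan

end

namespace InscribedFan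

open scoped InnerProductSpace
open Filter Topology

section

variable {E ι : Type*} [NormedAddCommGroup E] [InnerProductSpace ℝ E]

/-! ### Finite point configurations -/

/-! Index the vertices of P by the regions of its normal fan, as a family `p`. Adjacent regions are
then the edges of `p`, and the wall reflection is the reflection orthogonal to the edge
(`dualGraph_adj_iff`, `IsEdge.wallReflection_eq`).

An inscribed polytope normally equivalent to P, moved so that its sphere is centred at the origin,
has vertices `q R` of equal norm and edges that are positive multiples of those of `p`. Equal norms
force the wall reflection to carry `q R` to `q S` (`isReflective_of_norm_eq`). So `q` is determined
by `q R₀`, a vector of the inscribed space. Conversely, positivity of all edge lengths is an open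
condition, so small perturbations of `q R₀` inside the inscribed space again give inscribed
polytopes. Hence InCone spans a linear image of InSpc (`vectorSpan_inscribedCone`), and
full-dimensionality makes this image faithful (`injOn_piecewiseClass`). The two dimensions agree for
every base region.

It remains to see that closed walks act trivially exactly when P is even. If they do, walks define
isometries `T R` whose determinant changes sign across each edge, which two-colours every polygonal
face (`even_of_transport`). If P is even, the product of reflections around a polygon has
determinant 1, fixes the complement of its plane, and fixes a vertex of `q` with non-zero component
in that plane, so it is the identity (`eq_one_of_fixes_of_det_pos`). Polygons suffice
(`exists_transport`): `T` is built downwards from the top of a generic height, consistently because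
the ascending edges at a vertex are linked through two-dimensional faces
(`IsExposedFamily.ascending_edges_induction`). -/

/-- The linear function given by `c` attains its maximum over the configuration `p` at `i`. -/
def IsMaxAt (p : ι → E) (c : E) (i : ι) : Prop := ∀ k, ⟪c, p k⟫_ℝ ≤ ⟪c, p i⟫_ℝ

/-- The linear function given by `c` attains its maximum over `p` at `i` only. -/
def IsStrictMaxAt (p : ι → E) (c : E) (i : ι) : Prop := ∀ k, k ≠ i → ⟪c, p k⟫_ℝ < ⟪c, p i⟫_ℝ

/-- A configuration all of whose points are (distinct) vertices of its convex hull. -/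
def IsExposedFamily (p : ι → E) : Prop := ∀ i, ∃ c, IsStrictMaxAt p c i

/-- The points `p i` and `p j` span an edge of the convex hull of the configuration. -/
def IsEdge (p : ι → E) (i j : ι) : Prop :=
  i ≠ j ∧ ∃ c, ⟪c, p i⟫_ℝ = ⟪c, p j⟫_ℝ ∧ ∀ k, k ≠ i → k ≠ j → ⟪c, p k⟫_ℝ < ⟪c, p i⟫_ℝ

theorem IsEdge.symm {p : ι → E} {i j : ι} (h : IsEdge p i j) : IsEdge p j i := by
  obtain ⟨h1, c, h2, h3⟩ := h
  exact ⟨h1.symm, c, h2.symm, fun k hj hi => h2 ▸ h3 k hi hj⟩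

theorem IsStrictMaxAt.isMaxAt {p : ι → E} {c : E} {i : ι} (h : IsStrictMaxAt p c i) :
    IsMaxAt p c i := fun k => by
  rcases eq_or_ne k i with rfl | hk
  · exact le_rfl
  · exact (h k hk).le

theorem IsMaxAt.inner_eq {p : ι → E} {c : E} {i j : ι} (hi : IsMaxAt p c i) (hj : IsMaxAt p c j) :
    ⟪c, p i⟫_ℝ = ⟪c, p j⟫_ℝ := le_antisymm (hj i) (hi j)

theorem IsMaxAt.of_inner_eq {p : ι → E} {c : E} {i j : ι} (hi : IsMaxAt p c i)
    (h : ⟪c, p j⟫_ℝ = ⟪c, p i⟫_ℝ) : IsMaxAt p c j := fun k => h ▸ hi k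

theorem exists_isMaxAt [Finite ι] [Nonempty ι] (p : ι → E) (c : E) : ∃ i, IsMaxAt p c i :=
  Finite.exists_max fun i => ⟪c, p i⟫_ℝ

/-- The parametric step of the simplex method. -/
theorem exists_parametric_tie [Finite ι] {p : ι → E} {c c₀ : E} {i j : ι}
    (h₀ : IsStrictMaxAt p c₀ i) (hj : ⟪c, p i⟫_ℝ < ⟪c, p j⟫_ℝ) :
    ∃ r : ℝ, 0 < r ∧ ∃ k, ⟪c, p i⟫_ℝ < ⟪c, p k⟫_ℝ ∧ IsMaxAt p (c + r • c₀) i ∧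
      IsMaxAt p (c + r • c₀) k := by
  have : Nonempty ι := ⟨i⟩
  -- The quotient at `k` is the parameter at which `k` ties with `i`; the largest one is the last
  -- tie. At `i` itself it is 0/0 = 0, which is harmless because the quotient at `j` is positive.
  obtain ⟨k, hk⟩ := Finite.exists_max fun k => ⟪c, p k - p i⟫_ℝ / ⟪c₀, p i - p k⟫_ℝ
  have pos : ∀ l, l ≠ i → 0 < ⟪c₀, p i - p l⟫_ℝ := fun l hl => by
    rw [inner_sub_right]; linarith [h₀ l hl]
  have hji : j ≠ i := by rintro rfl; exact lt_irrefl _ hj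
  have hr : 0 < ⟪c, p k - p i⟫_ℝ / ⟪c₀, p i - p k⟫_ℝ :=
    (div_pos (by rw [inner_sub_right]; linarith) (pos j hji)).trans_le (hk j)
  have hki : k ≠ i := by rintro rfl; simp at hr
  have hmax : IsMaxAt p (c + (⟪c, p k - p i⟫_ℝ / ⟪c₀, p i - p k⟫_ℝ) • c₀) i := fun l => by
    rcases eq_or_ne l i with rfl | hl
    · exact le_rfl
    have h := (div_le_iff₀ (pos l hl)).1 (hk l)
    rw [inner_add_left, inner_add_left, real_inner_smul_left, real_inner_smul_left]
    rw [inner_sub_right c (p l), inner_sub_right c₀ (p i) (p l)] at h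
    linarith
  refine ⟨_, hr, k, ?_, hmax, hmax.of_inner_eq ?_⟩
  · have := (div_pos_iff_of_pos_right (pos k hki)).1 hr
    rw [inner_sub_right] at this; linarith
  · have h := div_mul_cancel₀ ⟪c, p k - p i⟫_ℝ (pos k hki).ne'
    rw [inner_add_left, inner_add_left, real_inner_smul_left, real_inner_smul_left]
    rw [inner_sub_right c (p k), inner_sub_right c₀ (p i) (p k)] at h ⊢
    linarith

theorem exists_forall_inner_ne_zero [FiniteDimensional ℝ E] [Finite ι] (w : ι → E) :
    ∃ g : E, ∀ i, w i ≠ 0 → ⟪g, w i⟫_ℝ ≠ 0 := by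
  obtain ⟨f, hf⟩ := Module.exists_dual_forall_apply_ne_zero (K := ℝ)
    (fun i : {i // w i ≠ 0} => w i) (fun i => i.2)
  refine ⟨(InnerProductSpace.toDual ℝ E).symm (LinearMap.toContinuousLinearMap f), fun i hi => ?_⟩
  rw [InnerProductSpace.toDual_symm_apply]
  exact hf ⟨i, hi⟩

theorem eventually_inner_add_smul_lt {a b : E} {c : E} (g : E) (h : ⟪c, a⟫_ℝ < ⟪c, b⟫_ℝ) :
    ∀ᶠ r : ℝ in 𝓝[>] 0, ⟪c + r • g, a⟫_ℝ < ⟪c + r • g, b⟫_ℝ := by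
  apply eventually_nhdsWithin_of_eventually_nhds
  have h1 : Continuous fun r : ℝ => ⟪c + r • g, a⟫_ℝ := by fun_prop
  have h2 : Continuous fun r : ℝ => ⟪c + r • g, b⟫_ℝ := by fun_prop
  exact h1.continuousAt.eventually_lt h2.continuousAt (by simpa using h)

theorem eventually_isStrictMaxAt [Finite ι] {p : ι → E} {c : E} {i : ι} (g : E)
    (h : IsStrictMaxAt p c i) : ∀ᶠ r : ℝ in 𝓝[>] 0, IsStrictMaxAt p (c + r • g) i := by
  rw [IsStrictMaxAt] at h
  simp only [IsStrictMaxAt, eventually_all]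
  exact fun k hk => eventually_inner_add_smul_lt g (h k hk)

theorem eventually_inner_add_smul_ne_zero {c g w : E} (h : ⟪g, w⟫_ℝ ≠ 0) :
    ∀ᶠ r : ℝ in 𝓝[>] 0, ⟪c + r • g, w⟫_ℝ ≠ 0 := by
  by_cases hc : ⟪c, w⟫_ℝ = 0
  · filter_upwards [self_mem_nhdsWithin] with r hr
    rw [inner_add_left, hc, zero_add, real_inner_smul_left]
    exact mul_ne_zero (ne_of_gt hr) h
  · apply eventually_nhdsWithin_of_eventually_nhds
    have h1 : Continuous fun r : ℝ => ⟪c + r • g, w⟫_ℝ := by fun_prop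
    exact h1.continuousAt.eventually_ne (by simpa using hc)

theorem exists_isStrictMaxAt_generic [FiniteDimensional ℝ E] [Finite ι] {κ : Type*} [Finite κ]
    {p : ι → E} {c : E} {i : ι} (h : IsStrictMaxAt p c i) (w : κ → E) :
    ∃ c', IsStrictMaxAt p c' i ∧ ∀ k, w k ≠ 0 → ⟪c', w k⟫_ℝ ≠ 0 := by
  obtain ⟨g, hg⟩ := exists_forall_inner_ne_zero w
  have h2 : ∀ᶠ r : ℝ in 𝓝[>] 0, ∀ k, w k ≠ 0 → ⟪c + r • g, w k⟫_ℝ ≠ 0 := by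
    simp only [eventually_all]
    exact fun k hk => eventually_inner_add_smul_ne_zero (hg k hk)
  obtain ⟨r, h1, h2⟩ := ((eventually_isStrictMaxAt g h).and h2).exists
  exact ⟨_, h1, h2⟩

/-- Rays from a point of the configuration through two other ones do not coincide. -/
theorem IsExposedFamily.smul_sub_ne {p : ι → E} (hp : IsExposedFamily p) {i j k : ι}
    (hij : i ≠ j) (hik : i ≠ k) (hjk : j ≠ k) {a b : ℝ} (ha : 0 < a) (hb : 0 < b) :
    a • (p k - p i) ≠ b • (p j - p i) := by
  -- For `a ≤ b` the relation puts `p j` on the segment from `p i` to `p k`, which no functional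
  -- exposing `j` allows.
  wlog hab : a ≤ b generalizing j k a b
  · exact (this hik hij hjk.symm hb ha (le_of_not_ge hab)).symm
  intro h
  obtain ⟨g, hg⟩ := hp j
  have h1 := congrArg (fun x => ⟪g, x⟫_ℝ) h
  simp only [real_inner_smul_right, inner_sub_right] at h1
  have h2 := hg i hij
  have h3 := hg k hjk.symm
  nlinarith

/-- The simplex method: a vertex which is not maximal has an improving edge. -/
theorem IsExposedFamily.exists_isEdge_lt [FiniteDimensional ℝ E] [Finite ι] {p : ι → E}
    (hp : IsExposedFamily p) {c : E} {i j : ι} (hj : ⟪c, p i⟫_ℝ < ⟪c, p j⟫_ℝ) :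
    ∃ k, IsEdge p i k ∧ ⟪c, p i⟫_ℝ < ⟪c, p k⟫_ℝ := by
  obtain ⟨c₀, h₀⟩ := hp i
  -- If two improving points tied with `i` at the same parameter, `c₁` would be orthogonal to the
  -- vector of that pair. This vector is non-zero because the rays differ, so genericity leaves a
  -- single tie, hence an edge.
  obtain ⟨c₁, h₁, hw⟩ := exists_isStrictMaxAt_generic h₀ fun q : ι × ι =>
    ⟪c, p q.1 - p i⟫_ℝ • (p q.2 - p i) - ⟪c, p q.2 - p i⟫_ℝ • (p q.1 - p i)
  obtain ⟨r, hr, k, hck, hi, hk⟩ := exists_parametric_tie h₁ hj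
  have hik : i ≠ k := by rintro rfl; exact lt_irrefl _ hck
  refine ⟨k, ⟨hik, _, hi.inner_eq hk, fun l hli hlk => (hi l).lt_of_ne fun hl => ?_⟩, hck⟩
  have hk' := hi.inner_eq hk
  have hl1 := h₁ l hli
  simp only [inner_add_left, real_inner_smul_left] at hl hk'
  have hcl : 0 < ⟪c, p l - p i⟫_ℝ := by
    rw [inner_sub_right]; nlinarith
  have hck' : 0 < ⟪c, p k - p i⟫_ℝ := by rw [inner_sub_right]; linarith
  refine hw (k, l) (sub_ne_zero.2 (hp.smul_sub_ne hik hli.symm hlk.symm hck' hcl)) ?_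
  simp only [inner_sub_right, real_inner_smul_right]
  have e1 : ⟪c, p l⟫_ℝ = ⟪c, p i⟫_ℝ + r * ⟪c₁, p i⟫_ℝ - r * ⟪c₁, p l⟫_ℝ := by linarith
  have e2 : ⟪c, p k⟫_ℝ = ⟪c, p i⟫_ℝ + r * ⟪c₁, p i⟫_ℝ - r * ⟪c₁, p k⟫_ℝ := by linarith
  rw [e1, e2]; ring

/-- The simplex method inside a face. -/
theorem IsExposedFamily.exists_isEdge_lt_of_isMaxAt [FiniteDimensional ℝ E] [Finite ι] {p : ι → E}
    (hp : IsExposedFamily p) {c g : E} {i j : ι} (hi : IsMaxAt p g i) (hj : IsMaxAt p g j)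
    (hij : ⟪c, p i⟫_ℝ < ⟪c, p j⟫_ℝ) :
    ∃ k, IsEdge p i k ∧ IsMaxAt p g k ∧ ⟪c, p i⟫_ℝ < ⟪c, p k⟫_ℝ := by
  -- For small `r`, every point off the face stays below `p i` for `g + r • c`, so an edge improving
  -- this functional must remain in the face.
  have h : ∀ᶠ r : ℝ in 𝓝[>] 0, ∀ k, ⟪g, p k⟫_ℝ < ⟪g, p i⟫_ℝ →
      ⟪g + r • c, p k⟫_ℝ < ⟪g + r • c, p i⟫_ℝ := by
    simp only [eventually_all]
    exact fun k hk => eventually_inner_add_smul_lt c hk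
  obtain ⟨r, h, hr⟩ := (h.and self_mem_nhdsWithin).exists
  have hr : 0 < r := hr
  have e := hi.inner_eq hj
  obtain ⟨k, hk, hik⟩ := hp.exists_isEdge_lt (c := g + r • c) (i := i) (j := j) (by
    simp only [inner_add_left, real_inner_smul_left, e]
    nlinarith)
  have hg : ⟪g, p k⟫_ℝ = ⟪g, p i⟫_ℝ := (hi k).antisymm <| not_lt.1 fun hlt => (h k hlt).not_gt hik
  refine ⟨k, hk, hi.of_inner_eq hg, ?_⟩
  simp only [inner_add_left, real_inner_smul_left, hg] at hik
  nlinarith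

/-- Any two vertices of a face are connected by edges of the face, in terms of invariants. -/
theorem IsExposedFamily.face_induction [FiniteDimensional ℝ E] [Finite ι] {p : ι → E}
    (hp : IsExposedFamily p) {g : E} {C : ι → Prop}
    (hC : ∀ i j, IsMaxAt p g i → IsMaxAt p g j → IsEdge p i j → C i → C j) {i j : ι}
    (hi : IsMaxAt p g i) (hj : IsMaxAt p g j) (h : C i) : C j := by
  obtain ⟨c, hc⟩ := hp j
  have : Nonempty {k // IsMaxAt p g k ∧ C k} := ⟨⟨i, hi, h⟩⟩
  -- The highest vertex of the face with property `C`, for a functional exposing `j`, must be `j`: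
  -- otherwise an improving edge leads to a higher one.
  obtain ⟨⟨k, hk, hCk⟩, hmax⟩ := Finite.exists_max
    fun k : {k // IsMaxAt p g k ∧ C k} => ⟪c, p k⟫_ℝ
  by_cases hkj : k = j
  · exact hkj ▸ hCk
  obtain ⟨l, hkl, hl, hlt⟩ := hp.exists_isEdge_lt_of_isMaxAt hk hj (hc k hkj)
  exact absurd (hmax ⟨l, hl, hC k l hk hl hkl hCk⟩) (not_le.2 hlt)

theorem isMaxAt_zero (p : ι → E) (i : ι) : IsMaxAt p 0 i := fun k => by simp

theorem IsExposedFamily.isMaxAt_of_edges [FiniteDimensional ℝ E] [Finite ι] {p : ι → E}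
    (hp : IsExposedFamily p) {c : E} {i : ι} (h : ∀ k, IsEdge p i k → ⟪c, p k⟫_ℝ ≤ ⟪c, p i⟫_ℝ) :
    IsMaxAt p c i := fun k => by
  by_contra! hk
  obtain ⟨l, hl, hlt⟩ := hp.exists_isEdge_lt hk
  exact (h l hl).not_gt hlt

/-! ### Directions of faces -/

/-- The direction of the face of the configuration on which `g` is maximal. -/
def faceDirection (p : ι → E) (g : E) : Submodule ℝ E := vectorSpan ℝ (p '' {k | IsMaxAt p g k})

theorem faceDirection_eq_span {p : ι → E} {g : E} {i : ι} (hi : IsMaxAt p g i) :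
    faceDirection p g = Submodule.span ℝ ((fun k => p k - p i) '' {k | IsMaxAt p g k}) := by
  rw [faceDirection, vectorSpan_eq_span_vsub_set_right ℝ (Set.mem_image_of_mem p hi),
    Set.image_image]
  rfl

theorem sub_mem_faceDirection {p : ι → E} {g : E} {i j : ι} (hi : IsMaxAt p g i)
    (hj : IsMaxAt p g j) : p i - p j ∈ faceDirection p g :=
  vsub_mem_vectorSpan ℝ (Set.mem_image_of_mem p hi) (Set.mem_image_of_mem p hj)

/-- The direction of a face is spanned by its edges at any of its vertices. -/
theorem IsExposedFamily.faceDirection_eq_span_edges [FiniteDimensional ℝ E] [Finite ι] {p : ι → E}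
    (hp : IsExposedFamily p) {g : E} {i : ι} (hi : IsMaxAt p g i) :
    faceDirection p g =
      Submodule.span ℝ ((fun k => p k - p i) '' {k | IsMaxAt p g k ∧ IsEdge p i k}) := by
  rw [faceDirection_eq_span hi]
  apply le_antisymm
  · rw [Submodule.span_le]
    rintro _ ⟨k, hk, rfl⟩
    rw [SetLike.mem_coe, ← Submodule.orthogonal_orthogonal
      (Submodule.span ℝ ((fun k => p k - p i) '' {k | IsMaxAt p g k ∧ IsEdge p i k})),
      Submodule.mem_orthogonal]
    -- A functional orthogonal to the edges at `i` has no improving edge there, so it does not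
    -- exceed its value at `i` on the face; `u` and `-u` together give equality.
    have key : ∀ u ∈ (Submodule.span ℝ
        ((fun k => p k - p i) '' {k | IsMaxAt p g k ∧ IsEdge p i k}))ᗮ,
        ⟪u, p k⟫_ℝ ≤ ⟪u, p i⟫_ℝ := by
      intro u hu
      by_contra! hlt
      obtain ⟨l, hl, hlg, hll⟩ := hp.exists_isEdge_lt_of_isMaxAt hi hk hlt
      have hmem : p l - p i ∈ Submodule.span ℝ
          ((fun k => p k - p i) '' {k | IsMaxAt p g k ∧ IsEdge p i k}) :=
        Submodule.subset_span ⟨l, ⟨hlg, hl⟩, rfl⟩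
      have := Submodule.inner_left_of_mem_orthogonal hmem hu
      rw [inner_sub_right] at this
      linarith
    intro u hu
    have h1 := key u hu
    have h2 := key (-u) (Submodule.neg_mem _ hu)
    rw [inner_neg_left, inner_neg_left] at h2
    rw [inner_sub_right]; linarith
  · exact Submodule.span_mono (Set.image_mono fun k hk => hk.1)

/-! ### Two-dimensional faces -/

theorem IsEdge.exists_functional {p : ι → E} {i j : ι} (h : IsEdge p i j) :
    ∃ c, ⟪c, p j - p i⟫_ℝ = 0 ∧ ∀ k, k ≠ i → k ≠ j → ⟪c, p k - p i⟫_ℝ < 0 := by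
  obtain ⟨-, c, h1, h2⟩ := h
  refine ⟨c, by rw [inner_sub_right, h1, sub_self], fun k hi hj => ?_⟩
  rw [inner_sub_right]; linarith [h2 k hi hj]

theorem IsEdge.linearIndependent_pair {p : ι → E} {i j k : ι} (hj : IsEdge p i j)
    (hk : IsEdge p i k) (hjk : j ≠ k) : LinearIndependent ℝ ![p j - p i, p k - p i] := by
  obtain ⟨c, hc, hc'⟩ := hj.exists_functional
  obtain ⟨c₁, hc₁, hc₁'⟩ := hk.exists_functional
  rw [LinearIndependent.pair_iff]
  intro a b h
  have h1 := congrArg (fun x => ⟪c, x⟫_ℝ) h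
  have h2 := congrArg (fun x => ⟪c₁, x⟫_ℝ) h
  simp only [inner_add_right, real_inner_smul_right, hc, hc₁, inner_zero_right, mul_zero,
    zero_add, add_zero, mul_eq_zero] at h1 h2
  exact ⟨h2.resolve_right (hc₁' j hj.1.symm hjk).ne, h1.resolve_right (hc' k hk.1.symm hjk.symm).ne⟩

/-- Each relation makes two coefficients vanish together or have opposite signs, and three reals
cannot have pairwise opposite signs. -/
theorem eq_zero_of_three_relations {a₁ a₂ a₃ x₂ x₃ y₁ y₃ z₁ z₂ : ℝ} (hx₂ : x₂ < 0) (hx₃ : x₃ < 0)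
    (hy₁ : y₁ < 0) (hy₃ : y₃ < 0) (hz₁ : z₁ < 0) (hz₂ : z₂ < 0) (hx : a₂ * x₂ + a₃ * x₃ = 0)
    (hy : a₁ * y₁ + a₃ * y₃ = 0) (hz : a₁ * z₁ + a₂ * z₂ = 0) : a₁ = 0 ∧ a₂ = 0 ∧ a₃ = 0 := by
  rcases lt_trichotomy a₃ 0 with h | h | h
  · have h2 : 0 < a₂ := by
      by_contra! h2
      nlinarith [mul_nonneg_of_nonpos_of_nonpos h2 hx₂.le, mul_pos_of_neg_of_neg h hx₃]
    have h1 : 0 < a₁ := by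
      by_contra! h1
      nlinarith [mul_nonneg_of_nonpos_of_nonpos h1 hy₁.le, mul_pos_of_neg_of_neg h hy₃]
    nlinarith [mul_neg_of_pos_of_neg h1 hz₁, mul_neg_of_pos_of_neg h2 hz₂]
  · subst h
    simp only [zero_mul, add_zero, mul_eq_zero, hx₂.ne, hy₁.ne, or_false] at hx hy
    exact ⟨hy, hx, rfl⟩
  · have h2 : a₂ < 0 := by
      by_contra! h2
      nlinarith [mul_nonpos_of_nonneg_of_nonpos h2 hx₂.le, mul_neg_of_pos_of_neg h hx₃]
    have h1 : a₁ < 0 := by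
      by_contra! h1
      nlinarith [mul_nonpos_of_nonneg_of_nonpos h1 hy₁.le, mul_neg_of_pos_of_neg h hy₃]
    nlinarith [mul_pos_of_neg_of_neg h1 hz₁, mul_pos_of_neg_of_neg h2 hz₂]

/-- The supporting functional of one edge kills its direction and is negative on the other two, so a
dependency yields three sign relations. This bounds vertex degrees in a two-dimensional face. -/
theorem IsEdge.linearIndependent_triple {p : ι → E} {i j k l : ι} (hj : IsEdge p i j)
    (hk : IsEdge p i k) (hl : IsEdge p i l) (hjk : j ≠ k) (hjl : j ≠ l) (hkl : k ≠ l) :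
    LinearIndependent ℝ ![p j - p i, p k - p i, p l - p i] := by
  obtain ⟨c₁, e₁, l₁⟩ := hj.exists_functional
  obtain ⟨c₂, e₂, l₂⟩ := hk.exists_functional
  obtain ⟨c₃, e₃, l₃⟩ := hl.exists_functional
  rw [Fintype.linearIndependent_iff]
  intro a h
  have h1 := congrArg (fun x => ⟪c₁, x⟫_ℝ) h
  have h2 := congrArg (fun x => ⟪c₂, x⟫_ℝ) h
  have h3 := congrArg (fun x => ⟪c₃, x⟫_ℝ) h
  simp only [Fin.sum_univ_three, Matrix.cons_val_zero, Matrix.cons_val_one, Matrix.cons_val,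
    inner_add_right, real_inner_smul_right, e₁, e₂, e₃, inner_zero_right, mul_zero,
    zero_add, add_zero] at h1 h2 h3
  obtain ⟨r1, r2, r3⟩ := eq_zero_of_three_relations (l₁ k hk.1.symm hjk.symm)
    (l₁ l hl.1.symm hjl.symm) (l₂ j hj.1.symm hjk) (l₂ l hl.1.symm hkl.symm)
    (l₃ j hj.1.symm hjl) (l₃ k hk.1.symm hkl) h1 h2 h3
  intro m
  fin_cases m
  · exact r1
  · exact r2
  · exact r3

/-- A vertex of a two-dimensional face has exactly two neighbours in the face. -/
theorem IsExposedFamily.ncard_neighbors_eq_two [FiniteDimensional ℝ E] [Finite ι] {p : ι → E}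
    (hp : IsExposedFamily p) {g : E} {i : ι} (hi : IsMaxAt p g i)
    (h2 : Module.finrank ℝ (faceDirection p g) = 2) :
    {k | IsMaxAt p g k ∧ IsEdge p i k}.ncard = 2 := by
  apply le_antisymm
  · by_contra! h
    obtain ⟨j, k, l, hj, hk, hl, hjk, hjl, hkl⟩ := (Set.two_lt_ncard_iff (Set.toFinite _)).1 h
    have hli := hj.2.linearIndependent_triple hk.2 hl.2 hjk hjl hkl
    have h3 := finrank_span_eq_card hli
    have hle : Submodule.span ℝ (Set.range ![p j - p i, p k - p i, p l - p i]) ≤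
        faceDirection p g := by
      rw [Submodule.span_le]
      rintro _ ⟨m, rfl⟩
      fin_cases m
      · exact sub_mem_faceDirection hj.1 hi
      · exact sub_mem_faceDirection hk.1 hi
      · exact sub_mem_faceDirection hl.1 hi
    have := Submodule.finrank_mono hle
    rw [h3, h2, Fintype.card_fin] at this
    omega
  · rw [← h2, hp.faceDirection_eq_span_edges hi]
    have hf : ((fun k => p k - p i) '' {k | IsMaxAt p g k ∧ IsEdge p i k}).Finite := Set.toFinite _
    have := hf.fintype
    calc _ ≤ _ := finrank_span_le_card (R := ℝ) _
      _ = ((fun k => p k - p i) '' {k | IsMaxAt p g k ∧ IsEdge p i k}).ncard := by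
        rw [Set.ncard_eq_toFinset_card']
      _ ≤ _ := Set.ncard_image_le (Set.toFinite _)

/-! ### Vertex figures and ascending edges -/

/-- The vertex figure of a configuration at `i`, cut out by the functional `c₀`. -/
noncomputable def vertexFigure (p : ι → E) (c₀ : E) (i : ι) (k : {k // IsEdge p i k}) : E :=
  (⟪c₀, p i - p k⟫_ℝ)⁻¹ • (p k - p i)

theorem inner_vertexFigure (p : ι → E) (c₀ c : E) (i : ι) (k : {k // IsEdge p i k}) :
    ⟪c, vertexFigure p c₀ i k⟫_ℝ = (⟪c₀, p i - p k⟫_ℝ)⁻¹ * ⟪c, p k - p i⟫_ℝ :=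
  real_inner_smul_right _ _ _

theorem IsStrictMaxAt.inv_inner_sub_pos {p : ι → E} {c₀ : E} {i : ι} (h₀ : IsStrictMaxAt p c₀ i)
    (k : {k // IsEdge p i k}) : 0 < (⟪c₀, p i - p k⟫_ℝ)⁻¹ := by
  rw [inv_pos, inner_sub_right]; linarith [h₀ k k.2.1.symm]

theorem isExposedFamily_vertexFigure {p : ι → E} {c₀ : E} {i : ι} (h₀ : IsStrictMaxAt p c₀ i) :
    IsExposedFamily (vertexFigure p c₀ i) := fun k => by
  obtain ⟨c, e, l⟩ := k.2.exists_functional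
  refine ⟨c, fun m hm => ?_⟩
  rw [inner_vertexFigure, inner_vertexFigure, e, mul_zero]
  exact mul_neg_of_pos_of_neg (h₀.inv_inner_sub_pos m)
    (l m m.2.1.symm fun h => hm (Subtype.ext h))

/-- Neighbours in the vertex figure lie in a common two-dimensional face. -/
theorem IsExposedFamily.exists_two_face [FiniteDimensional ℝ E] [Finite ι] {p : ι → E}
    (hp : IsExposedFamily p) {c₀ : E} {i : ι} (h₀ : IsStrictMaxAt p c₀ i) {k l : {k // IsEdge p i k}}
    (hkl : IsEdge (vertexFigure p c₀ i) k l) :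
    ∃ g, IsMaxAt p g i ∧ IsMaxAt p g k ∧ IsMaxAt p g l ∧
      Module.finrank ℝ (faceDirection p g) = 2 := by
  obtain ⟨hne, c, e, hlt⟩ := hkl
  -- On the vertex figure `c₀` is constantly -1. So `c + r • c₀` is non-positive along every edge
  -- leaving `i` and vanishes exactly along those to `k` and `l`, which therefore span the face it
  -- cuts out.
  set r := ⟪c, vertexFigure p c₀ i k⟫_ℝ
  have key : ∀ m : {k // IsEdge p i k}, ⟪c + r • c₀, p m⟫_ℝ - ⟪c + r • c₀, p i⟫_ℝ =
      ⟪c₀, p i - p m⟫_ℝ * (⟪c, vertexFigure p c₀ i m⟫_ℝ - r) := fun m => by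
    have hm := h₀.inv_inner_sub_pos m
    rw [inner_vertexFigure, mul_sub, mul_inv_cancel_left₀ (inv_pos.1 hm).ne']
    simp only [inner_add_left, real_inner_smul_left, inner_sub_right]
    ring
  have pos := fun m => inv_pos.1 (h₀.inv_inner_sub_pos m)
  have hi : IsMaxAt p (c + r • c₀) i := hp.isMaxAt_of_edges fun m hm => by
    have h := key ⟨m, hm⟩
    have h2 := pos ⟨m, hm⟩
    have h3 : ⟪c, vertexFigure p c₀ i ⟨m, hm⟩⟫_ℝ ≤ r := by
      by_cases hk : ⟨m, hm⟩ = k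
      · rw [hk]
      · by_cases hl : ⟨m, hm⟩ = l
        · rw [hl]; exact e.ge
        · exact (hlt _ hk hl).le
    dsimp only at h h2
    nlinarith
  have hk : IsMaxAt p (c + r • c₀) k := hi.of_inner_eq <| by
    have := key k; rw [sub_self, mul_zero] at this; linarith
  have hl : IsMaxAt p (c + r • c₀) l := hi.of_inner_eq <| by
    have := key l; rw [← e, sub_self, mul_zero] at this; linarith
  refine ⟨_, hi, hk, hl, ?_⟩
  have hset : {m | IsMaxAt p (c + r • c₀) m ∧ IsEdge p i m} = {k.1, l.1} := by
    ext m
    simp only [Set.mem_ofPred_eq, Set.mem_insert_iff, Set.mem_singleton_iff]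
    constructor
    · rintro ⟨hm, hm'⟩
      by_contra! hcon
      have h := key ⟨m, hm'⟩
      have h3 := hlt ⟨m, hm'⟩ (fun h => hcon.1 (congrArg Subtype.val h))
        (fun h => hcon.2 (congrArg Subtype.val h))
      rw [hm.inner_eq hi, sub_self] at h
      have h4 := pos ⟨m, hm'⟩
      dsimp only at h4 h
      nlinarith
    · rintro (rfl | rfl)
      · exact ⟨hk, k.2⟩
      · exact ⟨hl, l.2⟩
  have hli := k.2.linearIndependent_pair l.2 fun h => hne (Subtype.ext h)
  have h3 := finrank_span_eq_card hli
  rw [hp.faceDirection_eq_span_edges hi, hset, Set.image_pair]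
  rwa [Matrix.range_cons, Matrix.range_cons, Matrix.range_empty, Set.union_empty,
    Set.singleton_union, Fintype.card_fin] at h3

/-- The ascending edges at a vertex are connected to each other through two-dimensional faces. -/
theorem IsExposedFamily.ascending_edges_induction [FiniteDimensional ℝ E] [Finite ι] {p : ι → E}
    (hp : IsExposedFamily p) {c : E} {i : ι} {C : ι → Prop}
    (hC : ∀ g k l, IsMaxAt p g i → IsMaxAt p g k → IsMaxAt p g l →
      Module.finrank ℝ (faceDirection p g) = 2 → IsEdge p i k → IsEdge p i l →
      ⟪c, p i⟫_ℝ < ⟪c, p k⟫_ℝ → ⟪c, p i⟫_ℝ < ⟪c, p l⟫_ℝ → (C k → C l))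
    {k l : ι} (hk : IsEdge p i k) (hl : IsEdge p i l) (hck : ⟪c, p i⟫_ℝ < ⟪c, p k⟫_ℝ)
    (hcl : ⟪c, p i⟫_ℝ < ⟪c, p l⟫_ℝ) (h : C k) : C l := by
  obtain ⟨c₀, h₀⟩ := hp i
  have hq := isExposedFamily_vertexFigure h₀
  have hup : ∀ m : {k // IsEdge p i k},
      0 < ⟪c, vertexFigure p c₀ i m⟫_ℝ ↔ ⟪c, p i⟫_ℝ < ⟪c, p m⟫_ℝ := fun m => by
    rw [inner_vertexFigure, mul_pos_iff_of_pos_left (h₀.inv_inner_sub_pos m), inner_sub_right,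
      sub_pos]
  -- Ascending edges are the points of the vertex figure where `c` is positive. An improving path
  -- preserves positivity, so it reaches the top face without leaving them.
  have climb : ∀ D : ι → Prop, (∀ m n : {k // IsEdge p i k}, IsEdge (vertexFigure p c₀ i) m n →
      ⟪c, p i⟫_ℝ < ⟪c, p m⟫_ℝ → ⟪c, p i⟫_ℝ < ⟪c, p n⟫_ℝ → D m → D n) →
      ∀ m : {k // IsEdge p i k}, ⟪c, p i⟫_ℝ < ⟪c, p m⟫_ℝ → D m →
      ∃ n : {k // IsEdge p i k}, IsMaxAt (vertexFigure p c₀ i) c n ∧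
        ⟪c, p i⟫_ℝ < ⟪c, p n⟫_ℝ ∧ D n := by
    intro D hD m hm hDm
    have : Nonempty {n : {k // IsEdge p i k} // ⟪c, p i⟫_ℝ < ⟪c, p n⟫_ℝ ∧ D n} := ⟨⟨m, hm, hDm⟩⟩
    obtain ⟨⟨n, hn, hDn⟩, hmax⟩ := Finite.exists_max
      fun n : {n : {k // IsEdge p i k} // ⟪c, p i⟫_ℝ < ⟪c, p n⟫_ℝ ∧ D n} =>
        ⟪c, vertexFigure p c₀ i n⟫_ℝ
    refine ⟨n, fun a => ?_, hn, hDn⟩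
    by_contra! ha
    obtain ⟨b, hb, hlt⟩ := hq.exists_isEdge_lt ha
    have hb' := (hup b).1 (((hup n).2 hn).trans hlt)
    exact (hmax ⟨b, hb', hD n b hb hn hb' hDn⟩).not_gt hlt
  have step : ∀ m n : {k // IsEdge p i k}, IsEdge (vertexFigure p c₀ i) m n →
      ⟪c, p i⟫_ℝ < ⟪c, p m⟫_ℝ → ⟪c, p i⟫_ℝ < ⟪c, p n⟫_ℝ → C m → C n := by
    intro m n hmn hm hn
    obtain ⟨g, g1, g2, g3, g4⟩ := hp.exists_two_face h₀ hmn
    exact hC g m n g1 g2 g3 g4 m.2 n.2 hm hn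
  -- Climb from `k` carrying `C` and from `l` carrying its negation; both end in the top face of the
  -- vertex figure, whose connectedness gives the contradiction.
  by_contra hnot
  obtain ⟨m, hm, hcm, hCm⟩ := climb C step ⟨k, hk⟩ hck h
  obtain ⟨n, hn, hcn, hCn⟩ := climb (fun m => ¬ C m)
    (fun m n hmn hm hn hCm hCn => hCm (step n m hmn.symm hn hm hCn)) ⟨l, hl⟩ hcl hnot
  refine hCn (hq.face_induction (C := fun m => C m) (fun a b ha hb hab hCa => ?_) hm hn hCm)
  have hpos : ∀ a, IsMaxAt (vertexFigure p c₀ i) c a → ⟪c, p i⟫_ℝ < ⟪c, p a⟫_ℝ := fun a ha =>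
    (hup a).1 (((hup m).2 hcm).trans_le (ha m))
  exact step a b hab (hpos a ha) (hpos b hb) hCa

end

/-! ### Two-regular graphs -/

section TwoRegular

variable {V : Type*} [Fintype V] (G : V → V → Prop)

open Classical in
-- Double counting: each vertex occurs `k` times as first and `k` times as second end of an edge.
theorem sum_sum_add_of_regular {k : ℕ} (hsymm : ∀ x y, G x y → G y x)
    (h2 : ∀ x, (Finset.univ.filter (G x)).card = k) (f : V → ℤ) :
    ∑ x, ∑ y, (if G x y then f x + f y else 0) = 2 * k * ∑ x, f x := by
  have e1 : ∑ x, ∑ y, (if G x y then f x else 0) = k * ∑ x, f x := by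
    rw [Finset.mul_sum]
    refine Finset.sum_congr rfl fun x _ => ?_
    rw [← Finset.sum_filter, Finset.sum_const, h2, nsmul_eq_mul]
  have e2 : ∑ x, ∑ y, (if G x y then f y else 0) = ∑ x, ∑ y, (if G x y then f x else 0) := by
    rw [Finset.sum_comm]
    refine Finset.sum_congr rfl fun x _ => Finset.sum_congr rfl fun y _ => ?_
    simp only [show G y x ↔ G x y from ⟨hsymm _ _, hsymm _ _⟩]
  have e3 : ∀ x y, (if G x y then f x + f y else 0) =
      (if G x y then f x else 0) + (if G x y then f y else 0) := fun x y => by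
    split_ifs <;> simp
  simp only [e3, Finset.sum_add_distrib, e2, e1]
  ring

theorem even_sum_units_iff (f : V → ℤˣ) :
    Even (∑ x, (f x : ℤ)) ↔ Even (Fintype.card V) := by
  have h : ∀ s : Finset V, Even (∑ x ∈ s, (f x : ℤ)) ↔ Even s.card := by
    classical
    intro s
    induction s using Finset.induction_on with
    | empty => simp
    | insert a s ha ih =>
      rw [Finset.sum_insert ha, Finset.card_insert_of_notMem ha, Int.even_add, Nat.even_add_one, ih]
      rcases Int.units_eq_one_or (f a) with h | h <;> simp [h]
  exact h Finset.univ

open Classical in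
/-- A two-regular graph with a proper two-colouring has an even number of vertices. -/
theorem even_card_of_two_colouring (hsymm : ∀ x y, G x y → G y x)
    (h2 : ∀ x, (Finset.univ.filter (G x)).card = 2) (f : V → ℤˣ) (hf : ∀ x y, G x y → f y = - f x) :
    Even (Fintype.card V) := by
  have h := sum_sum_add_of_regular G hsymm h2 fun x => (f x : ℤ)
  rw [Finset.sum_eq_zero fun x _ => Finset.sum_eq_zero fun y _ => ?_] at h
  · rw [← even_sum_units_iff f]
    have : ∑ x, (f x : ℤ) = 0 := by push_cast at h; omega
    rw [this]; exact Even.zero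
  · split_ifs with hxy
    · rw [hf x y hxy]; simp
    · rfl

open Classical in
/-- A two-regular graph with an even number of vertices is two-colourable, if it has an injective
height function without local extrema apart from the minimum and the maximum. -/
theorem exists_two_colouring (hsymm : ∀ x y, G x y → G y x)
    (h2 : ∀ x, (Finset.univ.filter (G x)).card = 2) (hcard : Even (Fintype.card V))
    (c : V → ℝ) (hc : Function.Injective c)
    (hup : ∀ x y, c x < c y → ∃ z, G x z ∧ c x < c z)
    (hdown : ∀ x y, c y < c x → ∃ z, G x z ∧ c z < c x) (hirr : ∀ x, ¬ G x x) :
    ∃ f : V → ℤˣ, ∀ x y, G x y → f y = - f x := by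
  cases isEmpty_or_nonempty V
  · exact ⟨fun _ => 1, fun x => isEmptyElim x⟩
  obtain ⟨w, hw⟩ := Finite.exists_max c
  obtain ⟨y, z, hyz, hset⟩ := Finset.card_eq_two.1 (h2 w)
  have hwy : G w y := by
    have : y ∈ Finset.univ.filter (G w) := by rw [hset]; simp
    simpa using this
  have hwz : ∀ a, G w a → a = y ∨ a = z := fun a ha => by
    have : a ∈ Finset.univ.filter (G w) := by simpa using ha
    rw [hset] at this; simpa using this
  have hwz' : G w z := by
    have : z ∈ Finset.univ.filter (G w) := by rw [hset]; simp
    simpa using this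
  have hlt : ∀ a, G w a → c a < c w := fun a ha =>
    (hw a).lt_of_ne fun h => hirr w (by rwa [hc h] at ha)
  -- Without the edge from the top `w` to `y`, every vertex but the minimum has exactly one
  -- descending edge `d x`: `w` keeps only `z`, and any other vertex has one of its two neighbours
  -- above it. At the minimum `d x = x` is a default.
  have hd : ∀ x : V, ∃ d : V, (∀ a, G x a → c a < c x → (x = w ∧ a = y) ∨ a = d) ∧
      ((∃ a, c a < c x) → G x d ∧ c d < c x ∧ ¬ (x = w ∧ d = y)) := by
    intro x
    by_cases hx : ∃ a, c a < c x
    · by_cases hxw : x = w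
      · subst hxw
        exact ⟨z, fun a ha _ => (hwz a ha).imp (fun h => ⟨rfl, h⟩) id,
          fun _ => ⟨hwz', hlt z hwz', fun h => hyz h.2.symm⟩⟩
      · obtain ⟨a, ha⟩ := hx
        obtain ⟨d, hxd, hcd⟩ := hdown x a ha
        obtain ⟨u, hxu, hcu⟩ := hup x w ((hw x).lt_of_ne fun h => hxw (hc h))
        refine ⟨d, fun b hb hcb => Or.inr ?_, fun _ => ⟨hxd, hcd, fun h => hxw h.1⟩⟩
        by_contra hbd
        have h3 : ({b, d, u} : Finset V) ⊆ Finset.univ.filter (G x) := by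
          intro v hv
          simp only [Finset.mem_insert, Finset.mem_singleton] at hv
          rcases hv with rfl | rfl | rfl <;> simpa
        have h4 := Finset.card_le_card h3
        rw [h2, Finset.card_eq_three.2 ⟨b, d, u, hbd, ?_, ?_, rfl⟩] at h4
        · omega
        · rintro rfl; linarith
        · rintro rfl; linarith
    · push Not at hx
      exact ⟨x, fun a _ ha => absurd (hx a) (not_le.2 ha),
        fun ⟨a, ha⟩ => absurd (hx a) (not_le.2 ha)⟩
  choose d hd1 hd2 using hd
  have hwf : WellFounded fun a b : V => c a < c b :=
    @Finite.wellFounded_of_trans_of_irrefl V _ _ ⟨fun _ _ _ => lt_trans⟩ ⟨fun _ => lt_irrefl _⟩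
  -- Signs alternate along the descending path, starting from 1 at the minimum. Only the omitted
  -- edge may fail to be properly coloured.
  let f : V → ℤˣ := hwf.fix (C := fun _ => ℤˣ) fun x F => if h : c (d x) < c x then - F (d x) h else 1
  have hf : ∀ x, c (d x) < c x → f x = - f (d x) := fun x hx =>
    (hwf.fix_eq _ x).trans (dif_pos hx)
  have good : ∀ x a, G x a → c a < c x → ¬ (x = w ∧ a = y) → f x = - f a := by
    intro x a hxa hca hne
    obtain rfl := (hd1 x a hxa hca).resolve_left hne
    exact hf x hca
  have good' : ∀ x a, G x a → ¬ (x = w ∧ a = y) → ¬ (x = y ∧ a = w) → f a = - f x := by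
    intro x a hxa h1 h2
    rcases lt_trichotomy (c a) (c x) with h | h | h
    · rw [good x a hxa h h1, neg_neg]
    · exact absurd (hc h ▸ hxa) (hirr _)
    · exact good a x (hsymm _ _ hxa) h fun h => h2 ⟨h.2, h.1⟩
  by_cases hbad : f y = - f w
  · refine ⟨f, fun x a hxa => ?_⟩
    by_cases h1 : x = w ∧ a = y
    · rw [h1.1, h1.2, hbad]
    by_cases h2 : x = y ∧ a = w
    · rw [h2.1, h2.2, hbad, neg_neg]
    exact good' x a hxa h1 h2
  -- If the omitted edge is monochromatic, its two orientations contribute `4 * f w` to the double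
  -- sum, so the total of all signs is `f w`. That is odd, against the even number of vertices.
  · exfalso
    have hfy : f y = f w := by
      rcases Int.units_eq_one_or (f y) with h | h <;>
        rcases Int.units_eq_one_or (f w) with h' | h' <;> simp_all
    have hne : w ≠ y := fun h => hirr w (by rw [← h] at hwy; exact hwy)
    have h := sum_sum_add_of_regular G hsymm h2 fun x => (f x : ℤ)
    have e : ∀ x a, (if G x a then (f x : ℤ) + f a else 0) =
        (if x = w then (if a = y then 2 * (f w : ℤ) else 0) else 0) +
        (if x = y then (if a = w then 2 * (f w : ℤ) else 0) else 0) := by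
      intro x a
      by_cases h1 : x = w ∧ a = y
      · obtain ⟨rfl, rfl⟩ := h1
        rw [if_pos hwy, hfy, if_pos rfl, if_pos rfl, if_neg hne]; ring
      by_cases h2 : x = y ∧ a = w
      · obtain ⟨rfl, rfl⟩ := h2
        rw [if_pos (hsymm _ _ hwy), hfy, if_neg hne.symm, if_pos rfl, if_pos rfl]; ring
      have z1 : (if x = w then (if a = y then 2 * (f w : ℤ) else 0) else 0) = 0 := by
        split_ifs with p q
        · exact absurd ⟨p, q⟩ h1
        · rfl
        · rfl
      have z2 : (if x = y then (if a = w then 2 * (f w : ℤ) else 0) else 0) = 0 := by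
        split_ifs with p q
        · exact absurd ⟨p, q⟩ h2
        · rfl
        · rfl
      rw [z1, z2]
      split_ifs with hxa
      · rw [good' x a hxa h1 h2]; simp
      · rfl
    simp only [e, Finset.sum_add_distrib, Finset.sum_ite_irrel, Finset.sum_ite_eq',
      Finset.sum_const_zero, Finset.mem_univ, if_true] at h
    have hodd : ∑ x, (f x : ℤ) = f w := by push_cast at h; linarith
    have := (even_sum_units_iff f).2 hcard
    rw [hodd] at this
    rcases Int.units_eq_one_or (f w) with h | h <;> rw [h] at this <;> revert this <;> decide

end TwoRegular

section

variable {E ι : Type*} [NormedAddCommGroup E] [InnerProductSpace ℝ E]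

/-! ### Reflections along edges -/

/-- The determinant of a linear isometry. -/
noncomputable def isometryDet (t : E ≃ₗᵢ[ℝ] E) : ℝ := LinearMap.det t.toLinearEquiv.toLinearMap

theorem isometryDet_mul (s t : E ≃ₗᵢ[ℝ] E) :
    isometryDet (s * t) = isometryDet s * isometryDet t := by
  rw [isometryDet, isometryDet, isometryDet, ← LinearMap.det_comp]
  rfl

@[simp]
theorem isometryDet_one : isometryDet (1 : E ≃ₗᵢ[ℝ] E) = 1 := by
  rw [isometryDet]
  exact LinearMap.det_id

/-- The reflection in the hyperplane orthogonal to `p i - p j`. -/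
noncomputable def edgeReflection (p : ι → E) (i j : ι) : E ≃ₗᵢ[ℝ] E := (ℝ ∙ (p i - p j))ᗮ.reflection

theorem edgeReflection_comm (p : ι → E) (i j : ι) : edgeReflection p i j = edgeReflection p j i := by
  have : (ℝ ∙ (p i - p j)) = (ℝ ∙ (p j - p i)) := by
    rw [← neg_sub, ← Set.neg_singleton, Submodule.span_neg]
  simp only [edgeReflection, this]

theorem edgeReflection_mul_self (p : ι → E) (i j : ι) :
    edgeReflection p i j * edgeReflection p i j = 1 :=
  Submodule.reflection_mul_reflection _

theorem edgeReflection_mul_comm (p : ι → E) (i j : ι) :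
    edgeReflection p i j * edgeReflection p j i = 1 := by
  rw [edgeReflection_comm p j i, edgeReflection_mul_self]

theorem edgeReflection_apply_of_inner_eq_zero {p : ι → E} {i j : ι} {x : E}
    (h : ⟪p i - p j, x⟫_ℝ = 0) : edgeReflection p i j x = x :=
  Submodule.reflection_mem_subspace_eq_self (Submodule.mem_orthogonal_singleton_iff_inner_right.2 h)

theorem isometryDet_edgeReflection [FiniteDimensional ℝ E] {p : ι → E} {i j : ι} (h : p i ≠ p j) :
    isometryDet (edgeReflection p i j) = -1 := by
  have := Submodule.det_reflection (𝕜 := ℝ) (ℝ ∙ (p i - p j))ᗮ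
  rw [Submodule.orthogonal_orthogonal, finrank_span_singleton (sub_ne_zero.2 h), pow_one] at this
  exact this

theorem IsExposedFamily.injective {p : ι → E} (hp : IsExposedFamily p) : Function.Injective p := by
  intro i j h
  by_contra hij
  obtain ⟨c, hc⟩ := hp i
  have := hc j (Ne.symm hij)
  rw [h] at this
  exact lt_irrefl _ this

/-- A rotation in a plane with a fixed vector is trivial. -/
theorem eq_one_of_fixes_of_det_pos [FiniteDimensional ℝ E] {L : Submodule ℝ E}
    (hL : Module.finrank ℝ L = 2) {t : E ≃ₗᵢ[ℝ] E} (ht : ∀ x ∈ Lᗮ, t x = x) {v : E} (hv : v ∉ Lᗮ)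
    (htv : t v = v) (hdet : 0 < isometryDet t) : t = 1 := by
  -- `H` is fixed pointwise and has codimension at most one, so `t` acts on its complement by a
  -- sign. The sign -1 on a line would make `t` a reflection, of negative determinant.
  set H : Submodule ℝ E := Lᗮ ⊔ (ℝ ∙ v) with hHdef
  have htH : ∀ x ∈ H, t x = x := by
    intro x hx
    obtain ⟨y, hy, z, hz, rfl⟩ := Submodule.mem_sup.1 hx
    obtain ⟨a, rfl⟩ := Submodule.mem_span_singleton.1 hz
    rw [map_add, map_smul, ht y hy, htv]
  have hlt : Lᗮ < H := by
    refine lt_of_le_of_ne le_sup_left fun h => hv ?_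
    rw [h]
    exact Submodule.mem_sup_right (Submodule.mem_span_singleton_self v)
  have hH : Module.finrank ℝ Hᗮ ≤ 1 := by
    have h1 := Submodule.finrank_lt_finrank_of_lt hlt
    have h2 := Submodule.finrank_add_finrank_orthogonal L
    have h3 := Submodule.finrank_add_finrank_orthogonal H
    omega
  obtain ⟨⟨n, hn⟩, hspan⟩ := finrank_le_one_iff.1 hH
  have htn : t n ∈ Hᗮ := by
    rw [Submodule.mem_orthogonal]
    intro u hu
    rw [← htH u hu, t.inner_map_map]
    exact Submodule.inner_right_of_mem_orthogonal hu hn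
  obtain ⟨a, ha⟩ := hspan ⟨t n, htn⟩
  have ha : a • n = t n := congrArg Subtype.val ha
  have hor : t n = n ∨ t n = -n := by
    by_cases hn0 : n = 0
    · simp [hn0]
    have h1 : ‖a • n‖ = ‖n‖ := by rw [ha, t.norm_map]
    rw [norm_smul, Real.norm_eq_abs] at h1
    have h2 : |a| = 1 := mul_right_cancel₀ (norm_ne_zero_iff.2 hn0) (h1.trans (one_mul _).symm)
    rcases eq_or_eq_neg_of_abs_eq h2 with rfl | rfl
    · left; rw [← ha, one_smul]
    · right; rw [← ha, neg_one_smul]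
  have hcomp : ∀ x, ∃ y ∈ H, ∃ b : ℝ, x = y + b • n := fun x => by
    obtain ⟨y, hy, z, hz, hyz⟩ := H.exists_add_mem_mem_orthogonal x
    obtain ⟨b, hb⟩ := hspan ⟨z, hz⟩
    exact ⟨y, hy, b, by rw [hyz, show b • n = z from congrArg Subtype.val hb]⟩
  by_cases hfix : t n = n
  · ext x
    obtain ⟨y, hy, b, rfl⟩ := hcomp x
    rw [map_add, map_smul, htH y hy, hfix]
    rfl
  · have hneg := hor.resolve_left hfix
    have hn0 : n ≠ 0 := fun h => hfix (by rw [h, map_zero])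
    have hone : Module.finrank ℝ Hᗮ = 1 :=
      finrank_eq_one (⟨n, hn⟩ : Hᗮ) (fun h => hn0 (congrArg Subtype.val h)) hspan
    have heq : t = H.reflection := by
      ext x
      obtain ⟨y, hy, b, rfl⟩ := hcomp x
      rw [map_add, map_smul, htH y hy, hneg, map_add, map_smul,
        Submodule.reflection_mem_subspace_eq_self hy,
        Submodule.reflection_mem_subspace_orthogonalComplement_eq_neg hn]
    have h := Submodule.det_reflection (𝕜 := ℝ) H
    rw [hone, ← heq] at h
    have h' : isometryDet t = (-1) ^ 1 := h
    rw [h'] at hdet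
    norm_num at hdet

/-- A realization `q` of the vertices of a configuration on a sphere around the origin: along each
edge it is transformed by the reflection in the hyperplane orthogonal to the edge, and it moves in
the direction of the edge. -/
structure IsReflective (p q : ι → E) : Prop where
  reflection_eq : ∀ i j, IsEdge p i j → edgeReflection p i j (q i) = q j
  inner_pos : ∀ i j, IsEdge p i j → 0 < ⟪q i, p i - p j⟫_ℝ

/-! ### Trivial monodromy: from two-dimensional faces to the whole polytope -/

/-- A family of isometries which changes along each edge by the reflection. -/
theorem exists_transport_of_two_face [FiniteDimensional ℝ E] [Finite ι] {p q : ι → E}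
    (hp : IsExposedFamily p) (hq : IsReflective p q) {g : E}
    (h2 : Module.finrank ℝ (faceDirection p g) = 2) (heven : Even {k | IsMaxAt p g k}.ncard) :
    ∃ A : {k // IsMaxAt p g k} → (E ≃ₗᵢ[ℝ] E), ∀ j k : {k // IsMaxAt p g k},
      IsEdge p j.1 k.1 → A k = edgeReflection p j.1 k.1 * A j := by
  classical
  cases isEmpty_or_nonempty {k // IsMaxAt p g k} with
  | inl h => exact ⟨fun _ => 1, fun j => isEmptyElim j⟩
  | inr h =>
  obtain ⟨i₀, hi₀⟩ := h
  have hft : Fintype {k // IsMaxAt p g k} := Fintype.ofFinite _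
  obtain ⟨c, hc⟩ := exists_forall_inner_ne_zero fun x : ι × ι => p x.1 - p x.2
  have hcinj : ∀ j k, ⟪c, p j⟫_ℝ = ⟪c, p k⟫_ℝ → j = k := by
    intro j k h
    by_contra hjk
    refine hc (j, k) (sub_ne_zero.2 fun h => hjk (hp.injective h)) ?_
    rw [inner_sub_right, h, sub_self]
  obtain ⟨f, hf⟩ := exists_two_colouring (fun x y : {k // IsMaxAt p g k} => IsEdge p x.1 y.1)
    (fun x y h => h.symm)
    (fun x => by
      rw [← hp.ncard_neighbors_eq_two x.2 h2, ← Set.ncard_coe_finset,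
        ← Set.ncard_image_of_injective _ Subtype.val_injective]
      congr 1
      ext k
      simp only [Set.mem_image, SetLike.mem_coe, Finset.mem_filter, Finset.mem_univ, true_and,
        Subtype.exists, exists_and_right, exists_eq_right, Set.mem_ofPred_eq]
      exact ⟨fun ⟨a, b⟩ => ⟨a, b⟩, fun ⟨a, b⟩ => ⟨a, b⟩⟩)
    (by rw [← Nat.card_eq_fintype_card]; exact heven)
    (fun x => ⟪c, p x⟫_ℝ) (fun x y h => Subtype.ext (hcinj _ _ h))
    (fun x y h => by
      obtain ⟨k, hk, hgk, hlt⟩ := hp.exists_isEdge_lt_of_isMaxAt x.2 y.2 h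
      exact ⟨⟨k, hgk⟩, hk, hlt⟩)
    (fun x y h => by
      obtain ⟨k, hk, hgk, hlt⟩ := hp.exists_isEdge_lt_of_isMaxAt (c := -c) x.2 y.2
        (by rw [inner_neg_left, inner_neg_left]; exact neg_lt_neg h)
      rw [inner_neg_left, inner_neg_left] at hlt
      exact ⟨⟨k, hgk⟩, hk, neg_lt_neg_iff.1 hlt⟩)
    (fun x h => h.1 rfl)
  have fixes : ∀ j k, IsMaxAt p g j → IsMaxAt p g k → ∀ x ∈ (faceDirection p g)ᗮ,
      edgeReflection p j k x = x := fun j k hj hk x hx =>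
    edgeReflection_apply_of_inner_eq_zero
      (Submodule.inner_right_of_mem_orthogonal (sub_mem_faceDirection hj hk) hx)
  -- Composing reflections along any path from `i₀` to `j` gives such an `A`; the colouring `f`
  -- records the sign of its determinant independently of the path.
  have ex : ∀ j (hj : IsMaxAt p g j), ∃ A : E ≃ₗᵢ[ℝ] E, (∀ x ∈ (faceDirection p g)ᗮ, A x = x) ∧
      A (q i₀) = q j ∧ 0 < isometryDet A * ((f ⟨j, hj⟩ : ℤ) * (f ⟨i₀, hi₀⟩ : ℤ) : ℤ) := by
    intro j hj
    refine hp.face_induction (C := fun j => ∀ hj : IsMaxAt p g j, ∃ A : E ≃ₗᵢ[ℝ] E,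
      (∀ x ∈ (faceDirection p g)ᗮ, A x = x) ∧
      A (q i₀) = q j ∧ 0 < isometryDet A * ((f ⟨j, hj⟩ : ℤ) * (f ⟨i₀, hi₀⟩ : ℤ) : ℤ))
      ?_ hi₀ hj ?_ hj
    · intro j k hj hk hjk ih hk'
      obtain ⟨A, h1, h2, h3⟩ := ih hj
      refine ⟨edgeReflection p j k * A, fun x hx => ?_, ?_, ?_⟩
      · rw [LinearIsometryEquiv.coe_mul, Function.comp_apply, h1 x hx, fixes j k hj hk x hx]
      · rw [LinearIsometryEquiv.coe_mul, Function.comp_apply, h2, hq.reflection_eq j k hjk]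
      · rw [isometryDet_mul, isometryDet_edgeReflection (hp.injective.ne hjk.1),
          hf ⟨j, hj⟩ ⟨k, hk'⟩ hjk]
        push_cast at h3 ⊢
        linarith
    · intro _
      refine ⟨1, fun x _ => rfl, rfl, ?_⟩
      rw [isometryDet_one]
      rcases Int.units_eq_one_or (f ⟨i₀, hi₀⟩) with h | h <;> rw [h] <;> norm_num
  choose A hA1 hA2 hA3 using ex
  refine ⟨fun k => A k.1 k.2, fun ⟨j, hj⟩ ⟨k, hk⟩ hjk => ?_⟩
  rw [← inv_mul_eq_one]
  -- The neighbour `l` certifies that `q i₀` is not orthogonal to the plane of the face, as `q`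
  -- moves in the direction of that edge.
  obtain ⟨l, hl, hil⟩ : {k | IsMaxAt p g k ∧ IsEdge p i₀ k}.Nonempty :=
    Set.nonempty_of_ncard_ne_zero (by rw [hp.ncard_neighbors_eq_two hi₀ h2]; norm_num)
  have hinv : ∀ x y, A k hk x = y → (A k hk)⁻¹ y = x := fun x y h => by
    rw [← h, LinearIsometryEquiv.inv_def, LinearIsometryEquiv.symm_apply_apply]
  refine eq_one_of_fixes_of_det_pos h2 (v := q i₀) (fun x hx => ?_) (fun h => ?_) ?_ ?_
  · rw [LinearIsometryEquiv.coe_mul, LinearIsometryEquiv.coe_mul, Function.comp_apply,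
      Function.comp_apply, hA1 j hj x hx, fixes j k hj hk x hx]
    exact hinv _ _ (hA1 k hk x hx)
  · refine (hq.inner_pos i₀ l hil).ne' ?_
    exact Submodule.inner_left_of_mem_orthogonal (sub_mem_faceDirection hi₀ hl) h
  · rw [LinearIsometryEquiv.coe_mul, LinearIsometryEquiv.coe_mul, Function.comp_apply,
      Function.comp_apply, hA2 j hj, hq.reflection_eq j k hjk]
    exact hinv _ _ (hA2 k hk)
  · have h1 : isometryDet (A k hk) * isometryDet ((A k hk)⁻¹ * (edgeReflection p j k * A j hj)) =
        - isometryDet (A j hj) := by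
      rw [← isometryDet_mul, mul_inv_cancel_left, isometryDet_mul,
        isometryDet_edgeReflection (hp.injective.ne hjk.1), neg_one_mul]
    have h3 := hA3 k hk
    have h4 := hA3 j hj
    rw [hf ⟨j, hj⟩ ⟨k, hk⟩ hjk] at h3
    push_cast at h3 h4
    refine pos_of_mul_pos_right (b := isometryDet ((A k hk)⁻¹ * (edgeReflection p j k * A j hj)))
      (a := isometryDet (A k hk) * (-((f ⟨j, hj⟩ : ℤ) : ℝ) * ((f ⟨i₀, hi₀⟩ : ℤ) : ℝ))) ?_ h3.le
    calc 0 < _ := h4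
      _ = -(-isometryDet (A j hj)) * (((f ⟨j, hj⟩ : ℤ) : ℝ) * ((f ⟨i₀, hi₀⟩ : ℤ) : ℝ)) := by ring
      _ = _ := by rw [← h1]; ring

/-- If all two-dimensional faces are even, then reflections along edges can be integrated. -/
theorem exists_transport [FiniteDimensional ℝ E] [Finite ι] {p q : ι → E}
    (hp : IsExposedFamily p) (hq : IsReflective p q)
    (heven : ∀ g, Module.finrank ℝ (faceDirection p g) = 2 → Even {k | IsMaxAt p g k}.ncard) :
    ∃ T : ι → (E ≃ₗᵢ[ℝ] E), ∀ j k, IsEdge p j k → T k = edgeReflection p j k * T j := by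
  classical
  obtain ⟨c, hc⟩ := exists_forall_inner_ne_zero fun x : ι × ι => p x.1 - p x.2
  have hcinj : ∀ j k, ⟪c, p j⟫_ℝ = ⟪c, p k⟫_ℝ → j = k := by
    intro j k h
    by_contra hjk
    refine hc (j, k) (sub_ne_zero.2 fun h => hjk (hp.injective h)) ?_
    rw [inner_sub_right, h, sub_self]
  have hu : ∀ x, ∃ u, (∃ u', IsEdge p x u' ∧ ⟪c, p x⟫_ℝ < ⟪c, p u'⟫_ℝ) →
      IsEdge p x u ∧ ⟪c, p x⟫_ℝ < ⟪c, p u⟫_ℝ := fun x => by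
    by_cases h : ∃ u', IsEdge p x u' ∧ ⟪c, p x⟫_ℝ < ⟪c, p u'⟫_ℝ
    · exact ⟨h.choose, fun _ => h.choose_spec⟩
    · exact ⟨x, fun h' => absurd h' h⟩
  choose u hu using hu
  have hwf : WellFounded fun a b : ι => ⟪c, p b⟫_ℝ < ⟪c, p a⟫_ℝ :=
    @Finite.wellFounded_of_trans_of_irrefl ι _ _ ⟨fun _ _ _ h h' => h'.trans h⟩
      ⟨fun _ => lt_irrefl _⟩
  -- Recursion runs down from the top of the generic height `c`, along one chosen ascending edge per
  -- vertex; a vertex without one has `u x = x` and gets the identity.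
  let T : ι → (E ≃ₗᵢ[ℝ] E) := hwf.fix (C := fun _ => E ≃ₗᵢ[ℝ] E) fun x F =>
    if h : ⟪c, p x⟫_ℝ < ⟪c, p (u x)⟫_ℝ then edgeReflection p (u x) x * F (u x) h else 1
  have hT : ∀ x, ⟪c, p x⟫_ℝ < ⟪c, p (u x)⟫_ℝ → T x = edgeReflection p (u x) x * T (u x) :=
    fun x hx => (hwf.fix_eq _ x).trans (dif_pos hx)
  have main : ∀ x k, IsEdge p x k → ⟪c, p x⟫_ℝ < ⟪c, p k⟫_ℝ → T x = edgeReflection p k x * T k := by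
    intro x
    induction x using hwf.induction with
    | _ x ih =>
    intro k hk hck
    obtain ⟨hux, hcu⟩ := hu x ⟨k, hk, hck⟩
    refine hp.ascending_edges_induction (C := fun k => T x = edgeReflection p k x * T k)
      ?_ hux hk hcu hck (hT x hcu)
    intro g k l hx hgk hgl h2 hxk hxl hck hcl hCk
    obtain ⟨A, hA⟩ := exists_transport_of_two_face hp hq h2 (heven g h2)
    -- Above `x` the induction hypothesis makes `T` change like the transport `A` of the face. So
    -- `A⁻¹ * T` is constant on ascending paths in the face, and comparing at its top `w` shows that
    -- `k` and `l` prescribe the same `T x`.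
    have step : ∀ a b : {k // IsMaxAt p g k}, ⟪c, p x⟫_ℝ < ⟪c, p a⟫_ℝ → ⟪c, p a⟫_ℝ < ⟪c, p b⟫_ℝ →
        IsEdge p a.1 b.1 → (A a)⁻¹ * T a = (A b)⁻¹ * T b := by
      intro a b ha hab he
      rw [ih a ha b he hab, hA a b he, mul_inv_rev, mul_assoc, edgeReflection_comm p b a,
        inv_eq_of_mul_eq_one_left
          (edgeReflection_mul_self p a b)]
    have : Nonempty {k // IsMaxAt p g k} := ⟨⟨x, hx⟩⟩
    obtain ⟨w, hw⟩ := Finite.exists_max fun k : {k // IsMaxAt p g k} => ⟪c, p k⟫_ℝ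
    have top : ∀ a : ι, ∀ (ha : IsMaxAt p g a), ⟪c, p x⟫_ℝ < ⟪c, p a⟫_ℝ →
        (A ⟨a, ha⟩)⁻¹ * T a = (A w)⁻¹ * T w := by
      intro a
      induction a using hwf.induction with
      | _ a iha =>
      intro ha hxa
      by_cases haw : a = w.1
      · subst haw; rfl
      · obtain ⟨b, hab, hb, hlt⟩ := hp.exists_isEdge_lt_of_isMaxAt ha w.2
          ((hw ⟨a, ha⟩).lt_of_ne fun h => haw (hcinj _ _ h))
        rw [step ⟨a, ha⟩ ⟨b, hb⟩ hxa hlt hab, iha b hlt hb (hxa.trans hlt)]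
    have e := (top k hgk hck).trans (top l hgl hcl).symm
    have ek := hA ⟨x, hx⟩ ⟨k, hgk⟩ hxk
    have el := hA ⟨x, hx⟩ ⟨l, hgl⟩ hxl
    have hk' : T k = A ⟨k, hgk⟩ * ((A ⟨l, hgl⟩)⁻¹ * T l) := by rw [← e, mul_inv_cancel_left]
    have hkx : edgeReflection p k x * A ⟨k, hgk⟩ = A ⟨x, hx⟩ := by
      rw [ek, ← mul_assoc, edgeReflection_mul_comm, one_mul]
    have hlx : edgeReflection p l x * A ⟨l, hgl⟩ = A ⟨x, hx⟩ := by
      rw [el, ← mul_assoc, edgeReflection_mul_comm, one_mul]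
    rw [hCk, hk', ← mul_assoc, hkx, ← hlx, mul_assoc, mul_inv_cancel_left]
  refine ⟨T, fun j k hjk => ?_⟩
  rcases lt_trichotomy ⟪c, p j⟫_ℝ ⟪c, p k⟫_ℝ with h | h | h
  · rw [main j k hjk h, ← mul_assoc, edgeReflection_mul_comm, one_mul]
  · exact absurd (hcinj _ _ h) hjk.1
  · exact main k j hjk.symm h

/-- A family of isometries as above forces all two-dimensional faces to be even. -/
theorem even_of_transport [FiniteDimensional ℝ E] [Finite ι] {p : ι → E}
    (hp : IsExposedFamily p) {T : ι → (E ≃ₗᵢ[ℝ] E)}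
    (hT : ∀ j k, IsEdge p j k → T k = edgeReflection p j k * T j) {g : E}
    (h2 : Module.finrank ℝ (faceDirection p g) = 2) : Even {k | IsMaxAt p g k}.ncard := by
  classical
  have hft : Fintype {k // IsMaxAt p g k} := Fintype.ofFinite _
  have hdet : ∀ j, isometryDet (T j) ≠ 0 := fun j h => by
    have := isometryDet_mul (T j) (T j)⁻¹
    rw [mul_inv_cancel, h, zero_mul, isometryDet_one] at this
    exact one_ne_zero this
  have := even_card_of_two_colouring (fun x y : {k // IsMaxAt p g k} => IsEdge p x.1 y.1)
    (fun x y h => h.symm)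
    (fun x => by
      rw [← hp.ncard_neighbors_eq_two x.2 h2, ← Set.ncard_coe_finset,
        ← Set.ncard_image_of_injective _ Subtype.val_injective]
      congr 1
      ext k
      simp only [Set.mem_image, SetLike.mem_coe, Finset.mem_filter, Finset.mem_univ, true_and,
        Subtype.exists, exists_and_right, exists_eq_right, Set.mem_ofPred_eq]
      exact ⟨fun ⟨a, b⟩ => ⟨a, b⟩, fun ⟨a, b⟩ => ⟨a, b⟩⟩)
    -- Each edge reflection has determinant -1, so the sign of the determinant is a proper
    -- colouring.
    (fun x => if 0 < isometryDet (T x) then 1 else -1)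
    (fun x y hxy => by
      have h := hT x y hxy
      have h' := congrArg isometryDet h
      rw [isometryDet_mul, isometryDet_edgeReflection (hp.injective.ne hxy.1), neg_one_mul] at h'
      rw [h']
      rcases (hdet x).lt_or_gt with h0 | h0
      · rw [if_pos (by linarith), if_neg (by linarith), neg_neg]
      · rw [if_neg (by linarith), if_pos h0])
  rwa [← Nat.card_eq_fintype_card] at this

end

/-! ### Configurations with the same maximizers -/

section SameMax

variable {E ι : Type*} [NormedAddCommGroup E] [InnerProductSpace ℝ E]

theorem IsEdge.eventually_lt [Finite ι] {p : ι → E} {i j : ι} {c : E} (x : E)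
    (hc : ∀ k, k ≠ i → k ≠ j → ⟪c, p k⟫_ℝ < ⟪c, p i⟫_ℝ) :
    ∀ᶠ r : ℝ in 𝓝[>] 0, ∀ k, k ≠ i → k ≠ j → ⟪c + r • x, p k⟫_ℝ < ⟪c + r • x, p i⟫_ℝ := by
  simp only [eventually_all]
  exact fun k hi hj => eventually_inner_add_smul_lt x (hc k hi hj)

theorem isMaxAt_pair {p : ι → E} {i j : ι} {c : E} (h : ⟪c, p i⟫_ℝ = ⟪c, p j⟫_ℝ)
    (hc : ∀ k, k ≠ i → k ≠ j → ⟪c, p k⟫_ℝ < ⟪c, p i⟫_ℝ) : IsMaxAt p c i ∧ IsMaxAt p c j := by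
  have hi : IsMaxAt p c i := fun k => by
    by_cases h1 : k = i
    · rw [h1]
    by_cases h2 : k = j
    · rw [h2, h]
    exact (hc k h1 h2).le
  exact ⟨hi, hi.of_inner_eq h.symm⟩

/-- The linear functions which are maximal at both ends of an edge span the orthogonal complement
of the edge. -/
theorem IsEdge.span_isMaxAt_eq [Finite ι] {p : ι → E} {i j : ι} (h : IsEdge p i j) :
    Submodule.span ℝ {c | IsMaxAt p c i ∧ IsMaxAt p c j} = (ℝ ∙ (p i - p j))ᗮ := by
  apply le_antisymm
  · rw [Submodule.span_le]
    rintro c ⟨hi, hj⟩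
    rw [SetLike.mem_coe, Submodule.mem_orthogonal_singleton_iff_inner_left, inner_sub_right,
      hi.inner_eq hj, sub_self]
  · intro x hx
    rw [Submodule.mem_orthogonal_singleton_iff_inner_left, inner_sub_right, sub_eq_zero] at hx
    obtain ⟨-, c, hcij, hc⟩ := h
    -- For `x` orthogonal to the edge and small `r`, both `c` and `c + r • x` are maximal along it,
    -- and `x` is a multiple of their difference.
    obtain ⟨r, hr, hr0⟩ := ((IsEdge.eventually_lt x hc).and self_mem_nhdsWithin).exists
    have hr0 : 0 < r := hr0
    have h1 := Submodule.subset_span (R := ℝ) (s := {c | IsMaxAt p c i ∧ IsMaxAt p c j})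
      (isMaxAt_pair hcij hc)
    have h2 := Submodule.subset_span (R := ℝ) (s := {c | IsMaxAt p c i ∧ IsMaxAt p c j})
      (isMaxAt_pair (by simp only [inner_add_left, real_inner_smul_left, hx, hcij]) hr)
    have h3 := Submodule.smul_mem _ r⁻¹ (Submodule.sub_mem _ h2 h1)
    rwa [add_sub_cancel_left, inv_smul_smul₀ hr0.ne'] at h3

/-- No three exposed points are collinear: exposing `i` forces `0 < a`, exposing `j` forces `a < 1`,
and then `p k` lies between the other two and cannot be exposed. -/
theorem IsExposedFamily.sub_ne_smul {p : ι → E} (hp : IsExposedFamily p) {i j k : ι}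
    (hij : i ≠ j) (hik : i ≠ k) (hjk : j ≠ k) (a : ℝ) : p k - p i ≠ a • (p j - p i) := by
  intro h
  have key : ∀ g, ⟪g, p k⟫_ℝ - ⟪g, p i⟫_ℝ = a * (⟪g, p j⟫_ℝ - ⟪g, p i⟫_ℝ) := fun g => by
    simpa only [inner_sub_right, real_inner_smul_right] using congrArg (fun x => ⟪g, x⟫_ℝ) h
  obtain ⟨g₁, h₁⟩ := hp i
  obtain ⟨g₂, h₂⟩ := hp j
  obtain ⟨g₃, h₃⟩ := hp k
  have a0 : 0 < a := by
    have := key g₁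
    have := h₁ j hij.symm
    have := h₁ k hik.symm
    by_contra!
    nlinarith
  have a1 : a < 1 := by
    have := key g₂
    have := h₂ i hij
    have := h₂ k hjk.symm
    by_contra!
    nlinarith
  have := key g₃
  have := h₃ i hik
  have := h₃ j hjk
  nlinarith

/-- Configurations with the same maximizers have parallel edges. -/
theorem IsEdge.exists_sub_eq_smul [Finite ι] {p q : ι → E} (hp : IsExposedFamily p)
    (hpq : ∀ c i, IsMaxAt p c i ↔ IsMaxAt q c i) {i j : ι} (h : IsEdge p i j) :
    ∃ r : ℝ, 0 < r ∧ q j - q i = r • (p j - p i) := by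
  have hspan := h.span_isMaxAt_eq
  have h1 : q j - q i ∈ (ℝ ∙ (p i - p j))ᗮᗮ := by
    rw [← hspan, Submodule.mem_orthogonal]
    intro x hx
    induction hx using Submodule.span_induction with
    | mem c hc =>
      rw [inner_sub_right, ((hpq c i).1 hc.1).inner_eq ((hpq c j).1 hc.2), sub_self]
    | zero => exact inner_zero_left _
    | add x y _ _ hx hy => rw [inner_add_left, hx, hy, add_zero]
    | smul a x _ hx => rw [real_inner_smul_left, hx, mul_zero]
  rw [Submodule.orthogonal_orthogonal] at h1
  obtain ⟨a, ha⟩ := Submodule.mem_span_singleton.1 h1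
  obtain ⟨hij, c, hcij, hc⟩ := h
  have ha' : q j - q i = (-a) • (p j - p i) := by rw [← ha, neg_smul, ← smul_neg, neg_sub]
  refine ⟨-a, ?_, ha'⟩
  have hcq := ((hpq c i).1 (isMaxAt_pair hcij hc).1).inner_eq ((hpq c j).1 (isMaxAt_pair hcij hc).2)
  -- Tilting the edge functional towards `p j` makes `j` maximal and `i` not; the same holds for
  -- `q`, which fixes the sign of the factor.
  obtain ⟨r, hr, hr0⟩ := ((IsEdge.eventually_lt (p j - p i) hc).and self_mem_nhdsWithin).exists
  have hr0 : 0 < r := hr0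
  have hpos : 0 < ⟪p j - p i, p j - p i⟫_ℝ :=
    real_inner_self_pos.2 (sub_ne_zero.2 (hp.injective.ne hij.symm))
  have hlt : ⟪c + r • (p j - p i), p i⟫_ℝ < ⟪c + r • (p j - p i), p j⟫_ℝ := by
    rw [← sub_pos, ← inner_sub_right, inner_add_left, real_inner_smul_left, inner_sub_right, hcij,
      sub_self, zero_add]
    exact mul_pos hr0 hpos
  have hj : IsMaxAt p (c + r • (p j - p i)) j := fun k => by
    by_cases h1 : k = i
    · rw [h1]; exact hlt.le
    by_cases h2 : k = j
    · rw [h2]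
    exact ((hr k h1 h2).trans hlt).le
  have hjq := (hpq _ j).1 hj
  have hltq : 0 < ⟪c + r • (p j - p i), q j - q i⟫_ℝ := by
    rw [inner_sub_right, sub_pos]
    refine (hjq i).lt_of_ne fun h => ?_
    exact ((hpq _ i).2 (hjq.of_inner_eq h) j).not_gt hlt
  rw [inner_add_left, inner_sub_right, hcq, sub_self, zero_add, ha', real_inner_smul_left,
    real_inner_smul_right] at hltq
  exact pos_of_mul_pos_left ((pos_iff_pos_of_mul_pos hltq).1 hr0) hpos.le

/-- If corresponding edges are parallel and equally oriented, then the maximizers are the same. -/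
theorem IsExposedFamily.isMaxAt_iff_of_edges [FiniteDimensional ℝ E] [Finite ι] {p q : ι → E}
    (hp : IsExposedFamily p)
    (h : ∀ i j, IsEdge p i j → ∃ r : ℝ, 0 < r ∧ q j - q i = r • (p j - p i)) (c : E) (i : ι) :
    IsMaxAt p c i ↔ IsMaxAt q c i := by
  have key : ∀ i j, IsEdge p i j → ∃ r : ℝ, 0 < r ∧
      ⟪c, q j⟫_ℝ - ⟪c, q i⟫_ℝ = r * (⟪c, p j⟫_ℝ - ⟪c, p i⟫_ℝ) := fun i j hij => by
    obtain ⟨r, hr, e⟩ := h i j hij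
    exact ⟨r, hr, by
      simpa only [inner_sub_right, real_inner_smul_right] using congrArg (fun x => ⟪c, x⟫_ℝ) e⟩
  have hqp : ∀ i, IsMaxAt q c i → IsMaxAt p c i := fun i hi => by
    refine hp.isMaxAt_of_edges fun k hk => ?_
    obtain ⟨r, hr, e⟩ := key i k hk
    have := hi k
    by_contra!
    nlinarith
  refine ⟨fun hi => ?_, hqp i⟩
  have : Nonempty ι := ⟨i⟩
  obtain ⟨j, hj⟩ := exists_isMaxAt q c
  -- A maximizer for `q` lies in the face of `p`; along the edges of this face `c` is constant on
  -- `p`, hence on `q`, and the face is connected.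
  refine hp.face_induction (C := IsMaxAt q c) (fun k l hk hl hkl hkq => hkq.of_inner_eq ?_)
    (hqp j hj) hi hj
  obtain ⟨r, hr, e⟩ := key k l hkl
  rw [hk.inner_eq hl, sub_self, mul_zero] at e
  linarith

theorem IsExposedFamily.faceDirection_le [FiniteDimensional ℝ E] [Finite ι] {p q : ι → E}
    (hp : IsExposedFamily p) {c : E} {D : Submodule ℝ E}
    (h : ∀ i j, IsMaxAt p c i → IsMaxAt p c j → IsEdge p i j → q j - q i ∈ D) :
    vectorSpan ℝ (q '' {k | IsMaxAt p c k}) ≤ D := by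
  rw [vectorSpan_def, Submodule.span_le]
  rintro _ ⟨_, ⟨i, hi, rfl⟩, _, ⟨j, hj, rfl⟩, rfl⟩
  show q i - q j ∈ D
  refine hp.face_induction (C := fun k => q k - q j ∈ D) (fun k l hk hl hkl hkD => ?_) hj hi ?_
  · rw [← sub_add_sub_cancel (q l) (q k) (q j)]
    exact D.add_mem (h k l hk hl hkl) hkD
  · rw [sub_self]; exact D.zero_mem

theorem IsExposedFamily.faceDirection_eq_of_edges [FiniteDimensional ℝ E] [Finite ι] {p q : ι → E}
    (hp : IsExposedFamily p)
    (h : ∀ i j, IsEdge p i j → ∃ r : ℝ, 0 < r ∧ q j - q i = r • (p j - p i)) (c : E) :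
    faceDirection p c = faceDirection q c := by
  have hset : {k | IsMaxAt q c k} = {k | IsMaxAt p c k} :=
    Set.ext fun i => (hp.isMaxAt_iff_of_edges h c i).symm
  apply le_antisymm
  · refine hp.faceDirection_le fun i j hi hj hij => ?_
    obtain ⟨r, hr, e⟩ := h i j hij
    have := sub_mem_faceDirection ((hp.isMaxAt_iff_of_edges h c j).1 hj)
      ((hp.isMaxAt_iff_of_edges h c i).1 hi)
    rw [e] at this
    simpa [hr.ne'] using Submodule.smul_mem _ r⁻¹ this
  · rw [faceDirection, hset]
    refine hp.faceDirection_le fun i j hi hj hij => ?_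
    obtain ⟨r, hr, e⟩ := h i j hij
    rw [e]
    exact Submodule.smul_mem _ r (sub_mem_faceDirection hj hi)

end SameMax

/-! ### Convex hulls of configurations -/

section Hull

variable {d : ℕ} {ι : Type*}

theorem isPolytope_convexHull_range [Finite ι] [Nonempty ι] (p : ι → Space d) :
    IsPolytope (convexHull ℝ (Set.range p)) := by
  refine ⟨(Set.finite_range p).toFinset, ?_, by rw [Set.Finite.coe_toFinset]⟩
  rw [Set.Finite.toFinset_nonempty]
  exact Set.range_nonempty p

theorem inner_le_of_mem_convexHull_range {p : ι → Space d} {c x : Space d} {i : ι}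
    (hi : IsMaxAt p c i) (hx : x ∈ convexHull ℝ (Set.range p)) : ⟪c, x⟫_ℝ ≤ ⟪c, p i⟫_ℝ := by
  have hconv : Convex ℝ {x : Space d | ⟪c, x⟫_ℝ ≤ ⟪c, p i⟫_ℝ} :=
    convex_halfSpace_le (innerSL ℝ c).toLinearMap.isLinear _
  refine convexHull_min ?_ hconv hx
  rintro _ ⟨k, rfl⟩
  exact hi k

theorem mem_maxFace_iff {p : ι → Space d} {c : Space d} {i : ι} :
    p i ∈ maxFace (convexHull ℝ (Set.range p)) c ↔ IsMaxAt p c i :=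
  ⟨fun h k => h.2 _ (subset_convexHull ℝ _ ⟨k, rfl⟩), fun h =>
    ⟨subset_convexHull ℝ _ ⟨i, rfl⟩, fun _ hy => inner_le_of_mem_convexHull_range h hy⟩⟩

theorem isExposed_maxFace (P : Set (Space d)) (c : Space d) : IsExposed ℝ P (maxFace P c) :=
  fun _ => ⟨innerSL ℝ c, rfl⟩

theorem vertices_maxFace (P : Set (Space d)) (c : Space d) :
    vertices (maxFace P c) = maxFace P c ∩ vertices P :=
  (isExposed_maxFace P c).isExtreme.extremePoints_eq

theorem convexHull_vertices {P : Set (Space d)} (hP : IsCompact P) (hc : Convex ℝ P)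
    (hfin : (vertices P).Finite) : convexHull ℝ (vertices P) = P := by
  rw [← (hfin.isCompact_convexHull (𝕜 := ℝ)).isClosed.closure_eq]
  exact closure_convexHull_extremePoints hP hc

/-- The extreme points of the face are among the maximizing `p k`, and a compact convex set with
finitely many extreme points is their convex hull. -/
theorem maxFace_convexHull_range [Finite ι] (p : ι → Space d) (c : Space d) :
    maxFace (convexHull ℝ (Set.range p)) c = convexHull ℝ (p '' {k | IsMaxAt p c k}) := by
  have hcomp : IsCompact (convexHull ℝ (Set.range p)) :=
    (Set.finite_range p).isCompact_convexHull (𝕜 := ℝ)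
  have hexp := isExposed_maxFace (convexHull ℝ (Set.range p)) c
  have hsub : vertices (maxFace (convexHull ℝ (Set.range p)) c) ⊆ p '' {k | IsMaxAt p c k} := by
    rw [vertices_maxFace]
    rintro x ⟨hx, hx'⟩
    obtain ⟨k, rfl⟩ := extremePoints_convexHull_subset hx'
    exact ⟨k, mem_maxFace_iff.1 hx, rfl⟩
  apply le_antisymm
  · rw [← convexHull_vertices (hexp.isCompact hcomp) (hexp.convex (convex_convexHull ℝ _))
      ((Set.toFinite _).subset hsub)]
    exact convexHull_mono hsub
  · refine convexHull_min ?_ (hexp.convex (convex_convexHull ℝ _))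
    rintro _ ⟨k, hk, rfl⟩
    exact mem_maxFace_iff.2 hk

theorem vectorSpan_maxFace [Finite ι] (p : ι → Space d) (c : Space d) :
    vectorSpan ℝ (maxFace (convexHull ℝ (Set.range p)) c) = faceDirection p c := by
  rw [maxFace_convexHull_range, ← direction_affineSpan, affineSpan_convexHull,
    direction_affineSpan, faceDirection]

theorem normallyEquivalent_convexHull_range_iff [Finite ι] [Nonempty ι] {κ : Type*} [Finite κ]
    [Nonempty κ] {p : ι → Space d} {q : κ → Space d} :
    NormallyEquivalent (convexHull ℝ (Set.range p)) (convexHull ℝ (Set.range q)) ↔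
      ∀ c, faceDirection p c = faceDirection q c := by
  refine forall_congr' fun c => ?_
  obtain ⟨i, hi⟩ := exists_isMaxAt p c
  obtain ⟨j, hj⟩ := exists_isMaxAt q c
  have h1 : maxFace (convexHull ℝ (Set.range p)) c ≠ ∅ :=
    Set.Nonempty.ne_empty ⟨p i, mem_maxFace_iff.2 hi⟩
  have h2 : maxFace (convexHull ℝ (Set.range q)) c ≠ ∅ :=
    Set.Nonempty.ne_empty ⟨q j, mem_maxFace_iff.2 hj⟩
  rw [AffineSubspace.parallel_iff_direction_eq_and_eq_bot_iff_eq_bot, direction_affineSpan,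
    direction_affineSpan, vectorSpan_maxFace, vectorSpan_maxFace, affineSpan_eq_bot,
    affineSpan_eq_bot]
  simp [h1, h2]

theorem IsStrictMaxAt.setOf_isMaxAt_eq {p : ι → Space d} {c : Space d} {i : ι}
    (h : IsStrictMaxAt p c i) : {k | IsMaxAt p c k} = {i} := by
  ext k
  refine ⟨fun hk => ?_, fun hk => ?_⟩
  · by_contra hki
    exact (h k hki).not_ge (hk i)
  · rw [Set.mem_singleton_iff.1 hk]
    exact h.isMaxAt

theorem IsExposedFamily.vertices_convexHull_range [Finite ι] {p : ι → Space d}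
    (hp : IsExposedFamily p) : vertices (convexHull ℝ (Set.range p)) = Set.range p := by
  refine extremePoints_convexHull_subset.antisymm ?_
  rintro _ ⟨i, rfl⟩
  obtain ⟨c, hc⟩ := hp i
  have h : p i ∈ vertices (maxFace (convexHull ℝ (Set.range p)) c) := by
    rw [maxFace_convexHull_range, hc.setOf_isMaxAt_eq, Set.image_singleton, convexHull_singleton,
      vertices, extremePoints_singleton]
    rfl
  rw [vertices_maxFace] at h
  exact h.2

theorem supportFunction_convexHull_range {p : ι → Space d} {c : Space d} {i : ι}
    (hi : IsMaxAt p c i) : supportFunction (convexHull ℝ (Set.range p)) c = ⟪c, p i⟫_ℝ := by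
  refine IsGreatest.csSup_eq ⟨⟨p i, subset_convexHull ℝ _ ⟨i, rfl⟩, rfl⟩, ?_⟩
  rintro _ ⟨x, hx, rfl⟩
  exact inner_le_of_mem_convexHull_range hi hx

theorem IsPolytope.finite_vertices {P : Set (Space d)} (hP : IsPolytope P) :
    (vertices P).Finite := by
  obtain ⟨S, -, rfl⟩ := hP
  exact S.finite_toSet.subset extremePoints_convexHull_subset

theorem IsPolytope.convexHull_range_vertices {P : Set (Space d)} (hP : IsPolytope P) :
    convexHull ℝ (Set.range (Subtype.val : vertices P → Space d)) = P := by
  rw [Subtype.range_coe]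
  exact convexHull_vertices hP.isCompact hP.convex hP.finite_vertices

/-- A vertex is outside the compact hull of the finitely many others, so it can be strictly
separated from them. -/
theorem IsPolytope.isExposedFamily_vertices {P : Set (Space d)} (hP : IsPolytope P) :
    IsExposedFamily (Subtype.val : vertices P → Space d) := by
  rintro ⟨v, hv⟩
  have hv' := (hP.convex.mem_extremePoints_iff_mem_sdiff_convexHull_sdiff.1 hv).2
  have hfin : (vertices P \ {v}).Finite := hP.finite_vertices.subset Set.sdiff_subset
  have hv2 : v ∉ convexHull ℝ (vertices P \ {v}) := fun h =>
    hv' (convexHull_mono (Set.sdiff_subset_sdiff_left extremePoints_subset) h)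
  obtain ⟨f, u, hu, huv⟩ := geometric_hahn_banach_closed_point (convex_convexHull ℝ _)
    (hfin.isCompact_convexHull (𝕜 := ℝ)).isClosed hv2
  refine ⟨(InnerProductSpace.toDual ℝ (Space d)).symm f, fun k hk => ?_⟩
  rw [InnerProductSpace.toDual_symm_apply, InnerProductSpace.toDual_symm_apply]
  exact (hu k (subset_convexHull ℝ _ ⟨k.2, fun h => hk (Subtype.ext h)⟩)).trans huv

theorem IsExposedFamily.vertices_maxFace_convexHull_range [Finite ι] {p : ι → Space d}
    (hp : IsExposedFamily p) (c : Space d) :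
    vertices (maxFace (convexHull ℝ (Set.range p)) c) = p '' {k | IsMaxAt p c k} := by
  rw [vertices_maxFace, hp.vertices_convexHull_range]
  ext x
  constructor
  · rintro ⟨hx, k, rfl⟩
    exact ⟨k, mem_maxFace_iff.1 hx, rfl⟩
  · rintro ⟨k, hk, rfl⟩
    exact ⟨mem_maxFace_iff.2 hk, k, rfl⟩

theorem IsExposedFamily.isEven_convexHull_range_iff [Finite ι] {p : ι → Space d}
    (hp : IsExposedFamily p) : IsEven (convexHull ℝ (Set.range p)) ↔
      ∀ g, Module.finrank ℝ (faceDirection p g) = 2 → Even {k | IsMaxAt p g k}.ncard := by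
  have hcard : ∀ g, (vertices (maxFace (convexHull ℝ (Set.range p)) g)).ncard =
      {k | IsMaxAt p g k}.ncard := fun g => by
    rw [hp.vertices_maxFace_convexHull_range, Set.ncard_image_of_injective _ hp.injective]
  constructor
  · intro h g h2
    rw [← hcard]
    exact h _ ⟨g, rfl⟩ (by rwa [vectorSpan_maxFace])
  · rintro h _ ⟨g, rfl⟩ h2
    rw [vectorSpan_maxFace] at h2
    rw [hcard]
    exact h g h2

/-- For normally equivalent polytopes, generic linear functions have unique maximizers on both. -/
theorem IsExposedFamily.exists_isStrictMaxAt_of_faceDirection [Finite ι] {κ : Type*} [Finite κ]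
    [Nonempty κ] {p : ι → Space d} {q : κ → Space d} (hq : IsExposedFamily q)
    {c : Space d} (h : faceDirection p c = faceDirection q c) {i : ι} (hi : IsStrictMaxAt p c i) :
    ∃ j, IsStrictMaxAt q c j := by
  obtain ⟨j, hj⟩ := exists_isMaxAt q c
  refine ⟨j, fun k hk => (hj k).lt_of_ne fun hkj => hk (hq.injective ?_)⟩
  have hmem := sub_mem_faceDirection (hj.of_inner_eq hkj) hj
  rw [← h, faceDirection, hi.setOf_isMaxAt_eq, Set.image_singleton, vectorSpan_singleton,
    Submodule.mem_bot, sub_eq_zero] at hmem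
  exact hmem

/-- If some point of `q` beat `j` for `c'`, adding a suitable positive multiple of `c` would produce
a tie between two maximizers on `q`, while on `p` the sum still exposes `i` alone. Equal face
directions forbid this. -/
theorem isMaxAt_of_isStrictMaxAt [Finite ι] {κ : Type*} [Finite κ] [Nonempty κ] {p : ι → Space d}
    {q : κ → Space d} (hq : IsExposedFamily q) (h : ∀ c, faceDirection p c = faceDirection q c)
    {c c' : Space d} {i : ι} {j : κ} (hi : IsStrictMaxAt p c i) (hj : IsStrictMaxAt q c j)
    (hc' : IsMaxAt p c' i) : IsMaxAt q c' j := fun k => by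
  by_contra! hk
  obtain ⟨r, hr, l, hl, hmj, hml⟩ := exists_parametric_tie hj hk
  have hs : IsStrictMaxAt p (c' + r • c) i := fun m hm => by
    simp only [inner_add_left, real_inner_smul_left]
    have h1 := hc' m
    have h2 := hi m hm
    nlinarith
  obtain ⟨a, ha⟩ := hq.exists_isStrictMaxAt_of_faceDirection (h _) hs
  have e1 : j ∈ ({a} : Set κ) := ha.setOf_isMaxAt_eq ▸ hmj
  have e2 : l ∈ ({a} : Set κ) := ha.setOf_isMaxAt_eq ▸ hml
  rw [Set.mem_singleton_iff.1 e1, Set.mem_singleton_iff.1 e2] at hl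
  exact lt_irrefl _ hl

/-- The vertices of a polytope normally equivalent to the convex hull of `p` are indexed in the
same way, with the same maximizers. -/
theorem IsExposedFamily.exists_family_of_normallyEquivalent [Finite ι] [Nonempty ι]
    {p : ι → Space d} (hp : IsExposedFamily p) {Q : Set (Space d)} (hQ : IsPolytope Q)
    (h : NormallyEquivalent (convexHull ℝ (Set.range p)) Q) :
    ∃ q : ι → Space d, Q = convexHull ℝ (Set.range q) ∧ Set.range q = vertices Q ∧
      ∀ c i, IsMaxAt p c i ↔ IsMaxAt q c i := by
  have hfin : Finite (vertices Q) := hQ.finite_vertices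
  have hne : Nonempty (vertices Q) :=
    (hQ.isCompact.extremePoints_nonempty hQ.nonempty).to_subtype
  have hv := hQ.isExposedFamily_vertices
  have hull := hQ.convexHull_range_vertices
  rw [← hull, normallyEquivalent_convexHull_range_iff] at h
  choose c hc using hp
  -- Match `i` with the unique vertex of `Q` selected by a functional exposing `p i`.
  choose φ hφ using fun i => hv.exists_isStrictMaxAt_of_faceDirection (h (c i)) (hc i)
  have hsurj : Function.Surjective φ := fun j => by
    obtain ⟨a, ha⟩ := hv j
    obtain ⟨i, hi⟩ := IsExposedFamily.exists_isStrictMaxAt_of_faceDirection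
      (fun i => ⟨c i, hc i⟩) (h a).symm ha
    refine ⟨i, ?_⟩
    have := isMaxAt_of_isStrictMaxAt hv h (hc i) (hφ i) hi.isMaxAt
    have hmem : φ i ∈ {k : vertices Q | IsMaxAt Subtype.val a k} := this
    rwa [ha.setOf_isMaxAt_eq] at hmem
  have hrange : Set.range (fun i => (φ i : Space d)) = vertices Q := by
    exact (hsurj.range_comp Subtype.val).trans Subtype.range_coe
  refine ⟨fun i => φ i, ?_, hrange, fun c' i => ⟨fun hi k => ?_, fun hi => ?_⟩⟩
  · rw [hrange, convexHull_vertices hQ.isCompact hQ.convex hQ.finite_vertices]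
  · exact isMaxAt_of_isStrictMaxAt hv h (hc i) (hφ i) hi (φ k)
  · refine isMaxAt_of_isStrictMaxAt (fun i => ⟨c i, hc i⟩) (fun c => (h c).symm) (hφ i) (hc i)
      fun k => ?_
    obtain ⟨l, rfl⟩ := hsurj k
    exact hi l

end Hull

/-! ### Reflective families -/

section Reflective

variable {E ι : Type*} [NormedAddCommGroup E] [InnerProductSpace ℝ E]

theorem edgeReflection_sub_self (p : ι → E) (i j : ι) (x : E) :
    edgeReflection p i j x - x =
      (2 * ⟪x, p i - p j⟫_ℝ / ‖p i - p j‖ ^ 2) • (p j - p i) := by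
  rw [edgeReflection, Submodule.reflection_orthogonal_apply, Submodule.reflection_singleton_apply,
    real_inner_comm, ← neg_sub (p i) (p j), smul_neg, mul_div_assoc, mul_smul, two_smul, two_smul]
  simp only [RCLike.ofReal_real_eq_id, id_eq]
  abel

theorem IsReflective.exists_sub_eq_smul {p q : ι → E} (hp : IsExposedFamily p)
    (hq : IsReflective p q) (i j : ι) (h : IsEdge p i j) :
    ∃ r : ℝ, 0 < r ∧ q j - q i = r • (p j - p i) := by
  refine ⟨_, ?_, by rw [← hq.reflection_eq i j h, edgeReflection_sub_self]⟩
  have := hq.inner_pos i j h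
  have := norm_pos_iff.2 (sub_ne_zero.2 (hp.injective.ne h.1))
  positivity

/-- Two points of equal norm are swapped by the reflection orthogonal to their difference, here
parallel to the edge of `p`. -/
theorem isReflective_of_norm_eq {p q : ι → E} (hp : IsExposedFamily p)
    (hnorm : ∀ i j, ‖q i‖ = ‖q j‖)
    (h : ∀ i j, IsEdge p i j → ∃ r : ℝ, 0 < r ∧ q j - q i = r • (p j - p i)) :
    IsReflective p q := by
  have hrefl : ∀ i j, IsEdge p i j → edgeReflection p i j (q i) = q j := fun i j hij => by
    obtain ⟨r, hr, e⟩ := h i j hij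
    have e' : q i - q j = r • (p i - p j) := by rw [← neg_sub, e, ← smul_neg, neg_sub]
    have hs := Submodule.reflection_sub (hnorm i j)
    have hspan : (ℝ ∙ (q i - q j)) = (ℝ ∙ (p i - p j)) := by
      rw [e', Submodule.span_singleton_smul_eq (IsUnit.mk0 r hr.ne')]
    simp only [hspan] at hs
    exact hs
  refine ⟨hrefl, fun i j hij => ?_⟩
  obtain ⟨r, hr, e⟩ := h i j hij
  have hne := sub_ne_zero.2 (hp.injective.ne hij.1.symm)
  have hpos := norm_pos_iff.2 (sub_ne_zero.2 (hp.injective.ne hij.1))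
  rw [← hrefl i j hij, edgeReflection_sub_self] at e
  have e' := smul_left_injective ℝ hne e
  rw [div_eq_iff (by positivity)] at e'
  have : 0 < r * ‖p i - p j‖ ^ 2 := by positivity
  linarith

end Reflective

/-! ### Regions of normal fans -/

section Regions

variable {d : ℕ} {ι : Type*}

theorem mem_normalCone_maxFace_iff [Finite ι] {p : ι → Space d} {c c₀ : Space d} :
    c ∈ normalCone (convexHull ℝ (Set.range p)) (maxFace (convexHull ℝ (Set.range p)) c₀) ↔
      ∀ k, IsMaxAt p c₀ k → IsMaxAt p c k := by
  refine ⟨fun h k hk => mem_maxFace_iff.1 (h (mem_maxFace_iff.2 hk)), fun h => ?_⟩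
  rw [normalCone, Set.mem_ofPred_eq, maxFace_convexHull_range p c₀, maxFace_convexHull_range p c]
  exact convexHull_mono (Set.image_mono h)

theorem IsExposedFamily.setOf_isMaxAt_mem_normalFan [Finite ι] {p : ι → Space d}
    (hp : IsExposedFamily p) (i : ι) :
    {c | IsMaxAt p c i} ∈ normalFan (convexHull ℝ (Set.range p)) := by
  obtain ⟨c, hc⟩ := hp i
  refine ⟨_, ⟨c, rfl⟩, Set.ext fun c' => ?_⟩
  rw [mem_normalCone_maxFace_iff]
  refine ⟨fun h k hk => ?_, fun h => h i hc.isMaxAt⟩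
  have : k ∈ {k | IsMaxAt p c k} := hk
  rw [hc.setOf_isMaxAt_eq] at this
  rw [Set.mem_singleton_iff.1 this]
  exact h

theorem exists_subset_setOf_isMaxAt [Finite ι] [Nonempty ι] {p : ι → Space d} {N : Set (Space d)}
    (hN : N ∈ normalFan (convexHull ℝ (Set.range p))) : ∃ i, N ⊆ {c | IsMaxAt p c i} := by
  obtain ⟨_, ⟨c₀, rfl⟩, rfl⟩ := hN
  obtain ⟨i, hi⟩ := exists_isMaxAt p c₀
  exact ⟨i, fun c hc => mem_normalCone_maxFace_iff.1 hc i hi⟩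

/-- The regions of the normal fan are the normal cones at the vertices. -/
theorem IsExposedFamily.maximal_normalFan_iff [Finite ι] [Nonempty ι] {p : ι → Space d}
    (hp : IsExposedFamily p) {R : Set (Space d)} :
    Maximal (· ∈ normalFan (convexHull ℝ (Set.range p))) R ↔ ∃ i, R = {c | IsMaxAt p c i} := by
  constructor
  · intro h
    obtain ⟨i, hi⟩ := exists_subset_setOf_isMaxAt h.1
    exact ⟨i, hi.antisymm (h.2 (hp.setOf_isMaxAt_mem_normalFan i) hi)⟩
  · rintro ⟨i, rfl⟩
    refine ⟨hp.setOf_isMaxAt_mem_normalFan i, fun N hN hiN => ?_⟩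
    obtain ⟨k, hk⟩ := exists_subset_setOf_isMaxAt hN
    obtain ⟨c, hc⟩ := hp i
    have : k ∈ {k | IsMaxAt p c k} := hk (hiN hc.isMaxAt)
    rw [hc.setOf_isMaxAt_eq] at this
    rwa [Set.mem_singleton_iff.1 this] at hk

/-- The vertices of a polytope, indexed by the regions of its normal fan. -/
theorem IsPolytope.exists_region_family {P : Set (Space d)} (hP : IsPolytope P) :
    Finite (Region (normalFan P)) ∧ Nonempty (Region (normalFan P)) ∧
      ∃ p : Region (normalFan P) → Space d, IsExposedFamily p ∧ P = convexHull ℝ (Set.range p) ∧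
        ∀ R : Region (normalFan P), R.1 = {c | IsMaxAt p c R} := by
  have hfin : Finite (vertices P) := hP.finite_vertices
  have hne : Nonempty (vertices P) :=
    (hP.isCompact.extremePoints_nonempty hP.nonempty).to_subtype
  have hv := hP.isExposedFamily_vertices
  have hull := hP.convexHull_range_vertices
  have hmax : ∀ R, Maximal (· ∈ normalFan P) R ↔
      ∃ i : vertices P, R = {c | IsMaxAt Subtype.val c i} := fun R => by
    have := hv.maximal_normalFan_iff (R := R)
    rwa [hull] at this
  choose φ hφ using fun R : Region (normalFan P) => (hmax R.1).1 R.2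
  have hinj : Function.Injective φ := fun R S h => Subtype.ext (by rw [hφ R, hφ S, h])
  have hsurj : Function.Surjective φ := fun i => by
    refine ⟨⟨{c | IsMaxAt Subtype.val c i}, (hmax _).2 ⟨i, rfl⟩⟩, ?_⟩
    have h := hφ ⟨{c | IsMaxAt Subtype.val c i}, (hmax _).2 ⟨i, rfl⟩⟩
    obtain ⟨c, hc⟩ := hv i
    have h2 : c ∈ {c : Space d | IsMaxAt Subtype.val c i} := hc.isMaxAt
    dsimp only at h
    rw [h] at h2
    have h3 : φ _ ∈ {k : vertices P | IsMaxAt Subtype.val c k} := h2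
    rwa [hc.setOf_isMaxAt_eq] at h3
  refine ⟨Finite.of_injective φ hinj, hne.map fun i => (hsurj i).choose, fun R => φ R,
    fun R => ?_, ?_, fun R => ?_⟩
  · obtain ⟨c, hc⟩ := hv (φ R)
    exact ⟨c, fun S hS => hc (φ S) (hinj.ne hS)⟩
  · rw [show (Set.range fun R => (φ R : Space d)) = vertices P from
      (hsurj.range_comp Subtype.val).trans Subtype.range_coe]
    exact (convexHull_vertices hP.isCompact hP.convex hP.finite_vertices).symm
  · rw [hφ R]
    ext c
    refine ⟨fun h S => h (φ S), fun h i => ?_⟩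
    obtain ⟨S, rfl⟩ := hsurj i
    exact h S

variable {P : Set (Space d)} {p : Region (normalFan P) → Space d}

theorem finrank_orthogonal_singleton_add_one {x : Space d} (hx : x ≠ 0) :
    Module.finrank ℝ (ℝ ∙ x)ᗮ + 1 = d := by
  have h := Submodule.finrank_add_finrank_orthogonal (ℝ ∙ x)
  rw [finrank_span_singleton hx, finrank_euclideanSpace_fin] at h
  omega

theorem IsEdge.span_inter_eq [Finite (Region (normalFan P))]
    (hR : ∀ R : Region (normalFan P), R.1 = {c | IsMaxAt p c R})
    {R S : Region (normalFan P)} (h : IsEdge p R S) :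
    Submodule.span ℝ (R.1 ∩ S.1) = (ℝ ∙ (p R - p S))ᗮ := by
  rw [← h.span_isMaxAt_eq, hR R, hR S]
  rfl

/-- Two regions are adjacent if and only if the corresponding vertices span an edge. -/
theorem dualGraph_adj_iff [Finite (Region (normalFan P))] (hp : IsExposedFamily p)
    (hP : P = convexHull ℝ (Set.range p))
    (hR : ∀ R : Region (normalFan P), R.1 = {c | IsMaxAt p c R}) {R S : Region (normalFan P)} :
    (dualGraph (normalFan P)).Adj R S ↔ IsEdge p R S := by
  have hmem : ∀ c₀ c, c ∈ normalCone P (maxFace P c₀) ↔ ∀ k, IsMaxAt p c₀ k → IsMaxAt p c k :=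
    fun c₀ c => by
      have := mem_normalCone_maxFace_iff (p := p) (c := c) (c₀ := c₀)
      rwa [← hP] at this
  constructor
  · rintro ⟨hne, ⟨_, ⟨c, rfl⟩, hN⟩, hdim⟩
    have hle : Submodule.span ℝ (R.1 ∩ S.1) ≤ (ℝ ∙ (p R - p S))ᗮ := by
      rw [Submodule.span_le]
      rintro x ⟨hx, hx'⟩
      rw [hR R] at hx
      rw [hR S] at hx'
      rw [SetLike.mem_coe, Submodule.mem_orthogonal_singleton_iff_inner_left, inner_sub_right,
        IsMaxAt.inner_eq hx hx', sub_self]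
    have hspan : Submodule.span ℝ (R.1 ∩ S.1) = (ℝ ∙ (p R - p S))ᗮ := by
      refine Submodule.eq_of_le_of_finrank_eq hle ?_
      have := finrank_orthogonal_singleton_add_one (sub_ne_zero.2 (hp.injective.ne hne))
      omega
    -- The wall is the normal cone of the face cut out by `c`, so it contains `c`. A third maximizer
    -- of `c` would be orthogonally aligned with the whole wall, hence collinear with `p R` and `p
    -- S`.
    have hc : c ∈ R.1 ∩ S.1 := by rw [hN, hmem]; exact fun _ h => h
    have hcR : IsMaxAt p c R := by have := hc.1; rwa [hR R] at this
    have hcS : IsMaxAt p c S := by have := hc.2; rwa [hR S] at this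
    refine ⟨hne, c, hcR.inner_eq hcS, fun k hkR hkS => (hcR k).lt_of_ne fun hk => ?_⟩
    have hck := hcR.of_inner_eq hk
    have h1 : p k - p R ∈ (ℝ ∙ (p R - p S))ᗮᗮ := by
      rw [← hspan, Submodule.mem_orthogonal]
      intro x hx
      induction hx using Submodule.span_induction with
      | mem y hy =>
        have hyR := hy.1
        rw [hR R] at hyR
        rw [hN, hmem] at hy
        rw [inner_sub_right, (hy k hck).inner_eq hyR, sub_self]
      | zero => exact inner_zero_left _
      | add x y _ _ hx hy => rw [inner_add_left, hx, hy, add_zero]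
      | smul a x _ hx => rw [real_inner_smul_left, hx, mul_zero]
    rw [Submodule.orthogonal_orthogonal] at h1
    obtain ⟨a, ha⟩ := Submodule.mem_span_singleton.1 h1
    refine hp.sub_ne_smul hne hkR.symm hkS.symm (-a) ?_
    rw [← ha, neg_smul, ← smul_neg, neg_sub]
  · intro h
    refine ⟨h.1, ?_, ?_⟩
    · obtain ⟨-, c, hc, hlt⟩ := h
      refine ⟨_, ⟨c, rfl⟩, Set.ext fun x => ?_⟩
      rw [hmem, hR R, hR S]
      refine ⟨fun hx k hk => ?_, fun hx => ⟨hx R (isMaxAt_pair hc hlt).1,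
        hx S (isMaxAt_pair hc hlt).2⟩⟩
      by_cases h1 : k = R
      · rw [h1]; exact hx.1
      by_cases h2 : k = S
      · rw [h2]; exact hx.2
      exact absurd (hk R) (not_le.2 (hlt k h1 h2))
    · rw [h.span_inter_eq hR]
      exact finrank_orthogonal_singleton_add_one (sub_ne_zero.2 (hp.injective.ne h.1))

theorem IsEdge.wallReflection_eq [Finite (Region (normalFan P))]
    (hR : ∀ R : Region (normalFan P), R.1 = {c | IsMaxAt p c R})
    {R S : Region (normalFan P)} (h : IsEdge p R S) :
    wallReflection R.1 S.1 = edgeReflection p R S := by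
  simp only [wallReflection, h.span_inter_eq hR, edgeReflection]

end Regions

/-! ### Transformations along walks -/

section Walks

variable {d : ℕ} {𝓕 : Set (Set (Space d))}

theorem wallReflection_comm (R S : Set (Space d)) : wallReflection R S = wallReflection S R := by
  simp only [wallReflection, Set.inter_comm]

theorem walkTransform_apply_eq {q : Region 𝓕 → Space d}
    (hq : ∀ R S, (dualGraph 𝓕).Adj R S → wallReflection R.1 S.1 (q R) = q S) {R S : Region 𝓕}
    (w : (dualGraph 𝓕).Walk R S) : walkTransform w (q R) = q S := by
  induction w with
  | nil => rfl
  | cons h w ih => rw [walkTransform, LinearIsometryEquiv.trans_apply, hq _ _ h, ih]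

theorem walkTransform_append {R S T : Region 𝓕} (w : (dualGraph 𝓕).Walk R S)
    (w' : (dualGraph 𝓕).Walk S T) (x : Space d) :
    walkTransform (w.append w') x = walkTransform w' (walkTransform w x) := by
  induction w generalizing x with
  | nil => rfl
  | cons h w ih =>
    rw [SimpleGraph.Walk.cons_append, walkTransform, walkTransform,
      LinearIsometryEquiv.trans_apply, LinearIsometryEquiv.trans_apply, ih]

theorem walkTransform_reverse {R S : Region 𝓕} (w : (dualGraph 𝓕).Walk R S) (x : Space d) :
    walkTransform w.reverse (walkTransform w x) = x := by
  induction w generalizing x with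
  | nil => rfl
  | @cons u v _ h w ih =>
    have e : walkTransform (SimpleGraph.Walk.cons h w) x =
        walkTransform w (wallReflection u.1 v.1 x) := rfl
    rw [SimpleGraph.Walk.reverse_cons, walkTransform_append, e, ih, wallReflection_comm]
    exact Submodule.reflection_reflection _ x

/-- Vectors in the based inscribed space are transported independently of the walk. -/
theorem walkTransform_eq_of_mem {R₀ S : Region 𝓕} {v : Space d}
    (hv : v ∈ basedInscribedSpace 𝓕 R₀) (w w' : (dualGraph 𝓕).Walk R₀ S) :
    walkTransform w v = walkTransform w' v := by
  have h := hv.2 (w.append w'.reverse)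
  rw [walkTransform_append] at h
  have h' := walkTransform_reverse w'.reverse (walkTransform w v)
  rw [h, SimpleGraph.Walk.reverse_reverse] at h'
  exact h'.symm

end Walks

/-! ### The dimension of the inscribed cone -/

section Dimension

variable {d : ℕ} {P : Set (Space d)} {p : Region (normalFan P) → Space d}

/-- The vertices of an inscribed polytope normally equivalent to `P`, centred at the origin. -/
theorem exists_isReflective_of_mem_inscribedCone [Finite (Region (normalFan P))]
    [Nonempty (Region (normalFan P))] (hp : IsExposedFamily p)
    (hP : P = convexHull ℝ (Set.range p)) {x : FunctionsModLinear d} (hx : x ∈ inscribedCone P) :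
    ∃ q : Region (normalFan P) → Space d, IsReflective p q ∧
      ∀ ρ : Space d → Region (normalFan P), (∀ c, IsMaxAt p c (ρ c)) →
        x = (linearFunctions d).mkQ fun c => ⟪q (ρ c), c⟫_ℝ := by
  obtain ⟨Q, hQ, hPQ, ⟨z, r, hz⟩, rfl⟩ := hx
  have hPQ' : NormallyEquivalent (convexHull ℝ (Set.range p)) Q := by rwa [← hP]
  obtain ⟨q, rfl, hvert, hmax⟩ := hp.exists_family_of_normallyEquivalent hQ hPQ'
  have hnorm : ∀ R, ‖q R - z‖ = r := fun R => by
    rw [← dist_eq_norm]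
    exact hz _ (hvert ▸ ⟨R, rfl⟩)
  refine ⟨fun R => q R - z, isReflective_of_norm_eq hp (fun R S => by rw [hnorm, hnorm])
    fun R S h => ?_, fun ρ hρ => ?_⟩
  · rw [sub_sub_sub_cancel_right]
    exact h.exists_sub_eq_smul hp hmax
  · rw [supportClass, Submodule.mkQ_apply, Submodule.mkQ_apply, Submodule.Quotient.eq]
    -- Moving the centre `z` to the origin changes the support function by the linear function of
    -- `z`.
    refine ⟨(innerSL ℝ z).toLinearMap, funext fun c => ?_⟩
    have h1 := supportFunction_convexHull_range ((hmax c _).1 (hρ c))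
    show ⟪z, c⟫_ℝ = supportFunction (convexHull ℝ (Set.range q)) c - ⟪q (ρ c) - z, c⟫_ℝ
    rw [h1, inner_sub_left, real_inner_comm c (q (ρ c))]
    ring

theorem mem_inscribedCone_of_isReflective [Finite (Region (normalFan P))]
    [Nonempty (Region (normalFan P))] (hp : IsExposedFamily p)
    (hP : P = convexHull ℝ (Set.range p)) {q : Region (normalFan P) → Space d}
    (hq : IsReflective p q) (hnorm : ∀ R S, ‖q R‖ = ‖q S‖)
    {ρ : Space d → Region (normalFan P)} (hρ : ∀ c, IsMaxAt p c (ρ c)) :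
    (linearFunctions d).mkQ (fun c => ⟪q (ρ c), c⟫_ℝ) ∈ inscribedCone P := by
  have hedge := hq.exists_sub_eq_smul hp
  refine ⟨convexHull ℝ (Set.range q), isPolytope_convexHull_range q, ?_, ?_, ?_⟩
  · have := normallyEquivalent_convexHull_range_iff.2 (hp.faceDirection_eq_of_edges hedge)
    rwa [← hP] at this
  · obtain ⟨R⟩ := ‹Nonempty (Region (normalFan P))›
    refine ⟨0, ‖q R‖, fun v hv => ?_⟩
    obtain ⟨S, rfl⟩ := extremePoints_convexHull_subset hv
    rw [dist_zero_right]
    exact hnorm S R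
  · rw [supportClass]
    congr 1
    funext c
    rw [supportFunction_convexHull_range ((hp.isMaxAt_iff_of_edges hedge c _).1 (hρ c)),
      real_inner_comm]

/-- The piecewise linear functions given by linear functions on the regions, modulo linear
functions. -/
noncomputable def piecewiseClass {κ : Type*} (ρ : Space d → κ)
    (τ : κ → (Space d ≃ₗᵢ[ℝ] Space d)) : Space d →ₗ[ℝ] FunctionsModLinear d :=
  (linearFunctions d).mkQ ∘ₗ
    { toFun := fun v c => ⟪τ (ρ c) v, c⟫_ℝ
      map_add' := fun u v => funext fun c => by
        rw [map_add, inner_add_left]; rfl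
      map_smul' := fun a v => funext fun c => by
        rw [map_smul, real_inner_smul_left]; rfl }

theorem piecewiseClass_apply {κ : Type*} (ρ : Space d → κ)
    (τ : κ → (Space d ≃ₗᵢ[ℝ] Space d)) (v : Space d) :
    piecewiseClass ρ τ v = (linearFunctions d).mkQ fun c => ⟪τ (ρ c) v, c⟫_ℝ := rfl

/-- The edge graph is connected, so the edges span the direction of `P`, which is the whole space.
-/
theorem eq_zero_of_inner_edges_eq_zero [Finite (Region (normalFan P))] (hp : IsExposedFamily p)
    (hP : P = convexHull ℝ (Set.range p)) (hfull : IsFullDimensional P) {x : Space d}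
    (hx : ∀ R S, IsEdge p R S → ⟪x, p S - p R⟫_ℝ = 0) : x = 0 := by
  have h1 : vectorSpan ℝ (p '' {k | IsMaxAt p 0 k}) ≤ (ℝ ∙ x)ᗮ :=
    hp.faceDirection_le fun R S _ _ h =>
      Submodule.mem_orthogonal_singleton_iff_inner_right.2 (hx R S h)
  have h2 : p '' {k | IsMaxAt p 0 k} = Set.range p := by
    rw [← Set.image_univ]
    congr 1
    exact Set.eq_univ_of_forall fun k => isMaxAt_zero p k
  have h3 : vectorSpan ℝ (Set.range p) = ⊤ := by
    rw [← direction_affineSpan, ← affineSpan_convexHull, ← hP, hfull, AffineSubspace.direction_top]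
  rw [h2, h3] at h1
  exact inner_self_eq_zero.1
    (Submodule.mem_orthogonal_singleton_iff_inner_right.1 (h1 (Submodule.mem_top (x := x))))

/-- This makes the orthogonality condition in the inscribed space vacuous for full-dimensional `P`.
-/
theorem lineality_normalFan_subset [Finite (Region (normalFan P))] (hp : IsExposedFamily p)
    (hP : P = convexHull ℝ (Set.range p)) (hfull : IsFullDimensional P)
    (hR : ∀ R : Region (normalFan P), R.1 = {c | IsMaxAt p c R}) {x : Space d}
    (hx : x ∈ lineality (normalFan P)) : x = 0 := by
  refine eq_zero_of_inner_edges_eq_zero hp hP hfull fun R S _ => ?_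
  obtain ⟨h1, h2⟩ := hx R.1 R.2.1
  rw [hR R] at h1 h2
  have h1 := h1 S
  have h2 := h2 S
  rw [inner_neg_left, inner_neg_left] at h2
  rw [inner_sub_right]
  linarith

theorem exists_walk [Finite (Region (normalFan P))] (hp : IsExposedFamily p)
    (hP : P = convexHull ℝ (Set.range p))
    (hR : ∀ R : Region (normalFan P), R.1 = {c | IsMaxAt p c R}) (R S : Region (normalFan P)) :
    Nonempty ((dualGraph (normalFan P)).Walk R S) := by
  refine hp.face_induction (g := 0) (C := fun S => Nonempty ((dualGraph (normalFan P)).Walk R S))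
    (fun A B _ _ hAB ⟨w⟩ => ⟨w.append (.cons ((dualGraph_adj_iff hp hP hR).2 hAB) .nil)⟩)
    (isMaxAt_zero p R) (isMaxAt_zero p S) ⟨.nil⟩

/-- Transport of vectors in the inscribed space along the walks of a chosen family. -/
theorem walkTransform_edge [Finite (Region (normalFan P))] (hp : IsExposedFamily p)
    (hP : P = convexHull ℝ (Set.range p))
    (hR : ∀ R : Region (normalFan P), R.1 = {c | IsMaxAt p c R}) {R₀ R S : Region (normalFan P)}
    {v : Space d} (hv : v ∈ basedInscribedSpace (normalFan P) R₀) (h : IsEdge p R S)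
    (w : (dualGraph (normalFan P)).Walk R₀ R) (w' : (dualGraph (normalFan P)).Walk R₀ S) :
    edgeReflection p R S (walkTransform w v) = walkTransform w' v := by
  rw [walkTransform_eq_of_mem hv w'
    (w.append (.cons ((dualGraph_adj_iff hp hP hR).2 h) .nil)), walkTransform_append,
    ← h.wallReflection_eq hR]
  rfl

/-- A family which changes by reflections along edges is transported by the walk transformations. -/
theorem walkTransform_eq_of_edges [Finite (Region (normalFan P))] (hp : IsExposedFamily p)
    (hP : P = convexHull ℝ (Set.range p))
    (hR : ∀ R : Region (normalFan P), R.1 = {c | IsMaxAt p c R})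
    {q : Region (normalFan P) → Space d}
    (hq : ∀ R S, IsEdge p R S → edgeReflection p R S (q R) = q S)
    {R S : Region (normalFan P)} (w : (dualGraph (normalFan P)).Walk R S) :
    walkTransform w (q R) = q S :=
  walkTransform_apply_eq (fun R S h => by
    have h' := (dualGraph_adj_iff hp hP hR).1 h
    rw [h'.wallReflection_eq hR, hq R S h']) w

/-- The inscribed cone spans the image of the inscribed space. -/
theorem vectorSpan_inscribedCone [Finite (Region (normalFan P))]
    [Nonempty (Region (normalFan P))] (hp : IsExposedFamily p)
    (hP : P = convexHull ℝ (Set.range p)) (hfull : IsFullDimensional P)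
    (hR : ∀ R : Region (normalFan P), R.1 = {c | IsMaxAt p c R})
    (hinsc : IsNormallyInscribable P) {R₀ : Region (normalFan P)}
    (w : ∀ R, (dualGraph (normalFan P)).Walk R₀ R) {ρ : Space d → Region (normalFan P)}
    (hρ : ∀ c, IsMaxAt p c (ρ c)) :
    vectorSpan ℝ (inscribedCone P) =
      (basedInscribedSpace (normalFan P) R₀).map
        (piecewiseClass ρ fun R => walkTransform (w R)) := by
  set Φ := piecewiseClass ρ fun R => walkTransform (w R) with hΦ
  have up : ∀ x ∈ inscribedCone P, ∃ v ∈ basedInscribedSpace (normalFan P) R₀, x = Φ v ∧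
      IsReflective p fun R => walkTransform (w R) v := by
    intro x hx
    obtain ⟨q, hq, hxq⟩ := exists_isReflective_of_mem_inscribedCone hp hP hx
    have hw : ∀ R, walkTransform (w R) (q R₀) = q R := fun R =>
      walkTransform_eq_of_edges hp hP hR hq.reflection_eq (w R)
    refine ⟨q R₀, ⟨fun y hy => ?_, fun w' => ?_⟩, ?_, ?_⟩
    · rw [lineality_normalFan_subset hp hP hfull hR hy, inner_zero_left]
    · exact walkTransform_eq_of_edges hp hP hR hq.reflection_eq w'
    · rw [hxq ρ hρ, hΦ, piecewiseClass_apply]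
      simp only [hw]
    · simpa only [hw] using hq
  apply le_antisymm
  · rw [vectorSpan_def, Submodule.span_le]
    rintro _ ⟨x, hx, y, hy, rfl⟩
    obtain ⟨u, hu, rfl, -⟩ := up x hx
    obtain ⟨v, hv, rfl, -⟩ := up y hy
    exact ⟨u - v, Submodule.sub_mem _ hu hv, map_sub _ _ _⟩
  · rintro _ ⟨u, hu, rfl⟩
    obtain ⟨x, hx⟩ := hinsc
    obtain ⟨v, hv, rfl, hvr⟩ := up x hx
    -- Edge positivity survives a small step from `v` towards `u`, and isometries keep all norms
    -- equal. So `Φ (v + r • u)` is in the cone, and `Φ u` is a scaled difference of two of its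
    -- points.
    have hev : ∀ᶠ r : ℝ in 𝓝[>] 0, ∀ R S, IsEdge p R S →
        0 < ⟪walkTransform (w R) v + r • walkTransform (w R) u, p R - p S⟫_ℝ := by
      simp only [eventually_all]
      intro R S h
      have := eventually_inner_add_smul_lt (a := 0) (walkTransform (w R) u)
        (by simpa using hvr.inner_pos R S h)
      simpa using this
    obtain ⟨r, hr, hr0⟩ := (hev.and self_mem_nhdsWithin).exists
    have hr0 : 0 < r := hr0
    have hmem : v + r • u ∈ basedInscribedSpace (normalFan P) R₀ :=
      Submodule.add_mem _ hv (Submodule.smul_mem _ r hu)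
    have hcone : Φ (v + r • u) ∈ inscribedCone P := by
      refine mem_inscribedCone_of_isReflective hp hP
        (q := fun R => walkTransform (w R) (v + r • u))
        ⟨fun R S h => walkTransform_edge hp hP hR hmem h (w R) (w S), fun R S h => ?_⟩
        (fun R S => by simp only [LinearIsometryEquiv.norm_map]) hρ
      rw [map_add, map_smul]
      exact hr R S h
    have := vsub_mem_vectorSpan ℝ hcone hx
    rw [vsub_eq_sub, ← map_sub, add_sub_cancel_left, map_smul] at this
    have h2 := Submodule.smul_mem _ r⁻¹ this
    rwa [inv_smul_smul₀ hr0.ne'] at h2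

/-- If the piecewise linear function is linear with gradient `a`, its gradient on each region is
`a`. Then `a` is fixed by every edge reflection, so it is orthogonal to all edges and vanishes. -/
theorem injOn_piecewiseClass [Finite (Region (normalFan P))] (hp : IsExposedFamily p)
    (hP : P = convexHull ℝ (Set.range p)) (hfull : IsFullDimensional P)
    (hR : ∀ R : Region (normalFan P), R.1 = {c | IsMaxAt p c R}) {R₀ : Region (normalFan P)}
    (w : ∀ R, (dualGraph (normalFan P)).Walk R₀ R) {ρ : Space d → Region (normalFan P)}
    (hρ : ∀ c, IsMaxAt p c (ρ c)) {v : Space d}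
    (hv : v ∈ basedInscribedSpace (normalFan P) R₀)
    (h0 : piecewiseClass ρ (fun R => walkTransform (w R)) v = 0) : v = 0 := by
  rw [piecewiseClass_apply, Submodule.mkQ_apply, Submodule.Quotient.mk_eq_zero] at h0
  obtain ⟨f, hf⟩ := h0
  set a := (InnerProductSpace.toDual ℝ (Space d)).symm (LinearMap.toContinuousLinearMap f)
  have key : ∀ c, ⟪a, c⟫_ℝ = ⟪walkTransform (w (ρ c)) v, c⟫_ℝ := fun c =>
    InnerProductSpace.toDual_symm_apply.trans (congrFun hf c)
  have hρ' : ∀ c R, IsStrictMaxAt p c R → ρ c = R := fun c R h => by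
    have : ρ c ∈ {k | IsMaxAt p c k} := hρ c
    rwa [h.setOf_isMaxAt_eq] at this
  have hconst : ∀ R, walkTransform (w R) v = a := fun R => by
    obtain ⟨c, hc⟩ := hp R
    refine ext_inner_right ℝ fun y => ?_
    obtain ⟨r, hr, hr0⟩ := ((eventually_isStrictMaxAt y hc).and self_mem_nhdsWithin).exists
    have hr0 : 0 < r := hr0
    have h1 := key c
    have h2 := key (c + r • y)
    rw [hρ' _ _ hc] at h1
    rw [hρ' _ _ hr, inner_add_right, inner_add_right, h1, add_right_inj, real_inner_smul_right,
      real_inner_smul_right] at h2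
    exact (mul_left_cancel₀ hr0.ne' h2).symm
  have ha : a = 0 := by
    refine eq_zero_of_inner_edges_eq_zero hp hP hfull fun R S h => ?_
    have h1 := walkTransform_edge hp hP hR hv h (w R) (w S)
    rw [hconst, hconst, edgeReflection, Submodule.reflection_eq_self_iff,
      Submodule.mem_orthogonal_singleton_iff_inner_left, ← neg_sub, inner_neg_right,
      neg_eq_zero] at h1
    exact h1
  exact (walkTransform (w R₀)).map_eq_zero_iff.1 ((hconst R₀).trans ha)

theorem setDim_inscribedCone_eq_iff [Finite (Region (normalFan P))]
    [Nonempty (Region (normalFan P))] (hp : IsExposedFamily p)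
    (hP : P = convexHull ℝ (Set.range p)) (hfull : IsFullDimensional P)
    (hR : ∀ R : Region (normalFan P), R.1 = {c | IsMaxAt p c R})
    (hinsc : IsNormallyInscribable P) (R₀ : Region (normalFan P)) :
    setDim (inscribedCone P) = (d : Cardinal) ↔ basedInscribedSpace (normalFan P) R₀ = ⊤ := by
  choose ρ hρ using exists_isMaxAt p
  have w := fun R => (exists_walk hp hP hR R₀ R).some
  set Φ := piecewiseClass ρ fun R => walkTransform (w R)
  have hinj : Function.Injective (Φ.domRestrict (basedInscribedSpace (normalFan P) R₀)) := by
    rw [injective_iff_map_eq_zero]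
    rintro ⟨v, hv⟩ h0
    exact Subtype.ext (injOn_piecewiseClass hp hP hfull hR w hρ hv h0)
  have h := vectorSpan_inscribedCone hp hP hfull hR hinsc w hρ
  rw [setDim, h, ← LinearMap.range_domRestrict, rank_range_of_injective _ hinj,
    ← Module.finrank_eq_rank, Nat.cast_inj]
  refine ⟨fun h => Submodule.eq_top_of_finrank_eq (by rw [h, finrank_euclideanSpace_fin]),
    fun h => by rw [h, finrank_top, finrank_euclideanSpace_fin]⟩

/-- A polytope is even if and only if all its inscribed spaces are everything. -/
theorem isEven_iff_basedInscribedSpace_eq_top [Finite (Region (normalFan P))]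
    [Nonempty (Region (normalFan P))] (hp : IsExposedFamily p)
    (hP : P = convexHull ℝ (Set.range p)) (hfull : IsFullDimensional P)
    (hR : ∀ R : Region (normalFan P), R.1 = {c | IsMaxAt p c R})
    (hinsc : IsNormallyInscribable P) (R₀ : Region (normalFan P)) :
    IsEven P ↔ basedInscribedSpace (normalFan P) R₀ = ⊤ := by
  have heven : IsEven P ↔ ∀ g, Module.finrank ℝ (faceDirection p g) = 2 →
      Even {k | IsMaxAt p g k}.ncard := by
    have := hp.isEven_convexHull_range_iff
    rwa [← hP] at this
  rw [heven]
  constructor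
  · intro h
    obtain ⟨x, hx⟩ := hinsc
    obtain ⟨q, hq, -⟩ := exists_isReflective_of_mem_inscribedCone hp hP hx
    obtain ⟨T, hT⟩ := exists_transport hp hq h
    rw [eq_top_iff]
    refine fun v _ => ⟨fun y hy => ?_, fun w => ?_⟩
    · rw [lineality_normalFan_subset hp hP hfull hR hy, inner_zero_left]
    · have := walkTransform_eq_of_edges hp hP hR
        -- Any `v` is the value at `R₀` of this reflection-compatible family, so closed walks return
        -- it to itself.
        (q := fun R => T R ((T R₀).symm v)) (fun R S h => by rw [hT R S h]; rfl) w
      rwa [LinearIsometryEquiv.apply_symm_apply] at this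
  · intro h g h2
    have w := fun R => (exists_walk hp hP hR R₀ R).some
    refine even_of_transport hp (T := fun R => walkTransform (w R)) (fun R S hRS => ?_) h2
    ext1 v
    exact (walkTransform_edge hp hP hR (h ▸ Submodule.mem_top) hRS (w R) (w S)).symm

end Dimension

end InscribedFan

theorem mainTheorem6 (d : ℕ) (P : Set (InscribedFan.Space d))
    (hP : InscribedFan.IsPolytope P)
    (hfull : InscribedFan.IsFullDimensional P)
    (hinsc : InscribedFan.IsNormallyInscribable P) :
    List.TFAE
      [InscribedFan.IsEven P,
       InscribedFan.setDim (InscribedFan.inscribedCone P) = (d : Cardinal),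
       ∀ R₀ : InscribedFan.Region (InscribedFan.normalFan P),
         InscribedFan.basedInscribedSpace (InscribedFan.normalFan P) R₀ = ⊤,
       ∃ R₀ : InscribedFan.Region (InscribedFan.normalFan P),
         InscribedFan.basedInscribedSpace (InscribedFan.normalFan P) R₀ = ⊤] := by
  obtain ⟨hfin, hne, p, hp, hPp, hR⟩ := hP.exists_region_family
  have h1 := InscribedFan.isEven_iff_basedInscribedSpace_eq_top hp hPp hfull hR hinsc
  have h2 := InscribedFan.setDim_inscribedCone_eq_iff hp hPp hfull hR hinsc
  obtain ⟨R⟩ := id hne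
  tfae_have 1 ↔ 2 := (h1 R).trans (h2 R).symm
  tfae_have 1 → 3 := fun h R => (h1 R).1 h
  tfae_have 3 → 4 := fun h => ⟨R, h R⟩
  tfae_have 4 → 1 := fun ⟨R, h⟩ => (h1 R).2 h
  tfae_finish
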